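/- Let $k$ be a field and let $Z$ be an algebraic space of finite type over $k$ (algebraic spaces are understood to be quasi-separated; e.g. $Z$ may be any scheme of finite type over $k$), equipped with an action of $\mathbb{G}_m$. For a $k$-scheme $X$ with a $\mathbb{G}_m$-action let $\mathrm{Maps}^{\mathbb{G}_m}(X,Z)$ denote the space (functor on $k$-schemes) whose $S$-points are the $\mathbb{G}_m$-equivariant morphisms $S\times X\to Z$, where $\mathbb{G}_m$ acts trivially on $S$. Put $$Z^0:=\mathrm{Maps}^{\mathbb{G}_m}(\mathrm{Spec}\,k,Z),\qquad Z^+:=\mathrm{Maps}^{\mathbb{G}_m}(\mathbb{A}^1,Z),\qquad Z^-:=\mathrm{Maps}^{\mathbb{G}_m}(\mathbb{A}^1_-,Z),$$ where $\mathbb{G}_m$ acts on $\mathbb{A}^1=\mathbb{P}^1-\{\infty\}$ by dilations and on $\mathbb{A}^1_-=\mathbb{P}^1-\{0\}$ by the usual action on $\mathbb{P}^1$ (that is, by inverse dilations of the coordinate $t^{-1}$). Let $p^\pm:Z^\pm\to Z$ be the morphisms of evaluation at the point $1$, and let $i^\pm:Z^0\to Z^\pm$ be the morphisms induced by the projections $\mathbb{A}^1\to\mathrm{Spec}\,k$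 and $\mathbb{A}^1_-\to\mathrm{Spec}\,k$; both $p^+\circ i^+$ and $p^-\circ i^-$ equal the canonical embedding $Z^0\to Z$. Then the morphism $$j:=(i^+,i^-):Z^0\to Z^+\underset{Z}{\times}Z^-$$ is both an open embedding and a closed embedding; in particular, it is the embedding of a union of some connected components of $Z^+\times_Z Z^-$. Moreover, if $Z$ is an affine scheme, then $j$ is an isomorphism. -/

import Mathlib

universe u

open CategoryTheory Opposite AlgebraicGeometry

namespace GmSpace

open Limits MonoidalCategory CartesianMonoidalCategory

/-! ### Spaces over a field -/

/-- The category of schemes over `k`. -/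
abbrev Sch (k : Type u) [Field k] : Type (u + 1) :=
  Over (Spec (CommRingCat.of k))

/-- Presheaves of sets on the category of schemes over `k`; `Z.obj (op S)` is `Maps(S, Z)`. -/
abbrev PreSpace (k : Type u) [Field k] : Type (u + 1) :=
  (Sch k)ᵒᵖ ⥤ Type u

variable {k : Type u} [Field k]

/-- A morphism of presheaves is schematic with property `P`: its pullback to every scheme `S` over
`k` is representable by a scheme, whose projection to `S` has the property `P`. -/
def Schematic (P : MorphismProperty Scheme.{u}) : MorphismProperty (PreSpace k) :=
  (P.over (X := Spec (CommRingCat.of k))).presheaf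

/-- Open embeddings. -/
def IsOpenEmbedding {F G : PreSpace k} (f : F ⟶ G) : Prop :=
  Schematic @IsOpenImmersion f

/-- Closed embeddings. -/
def IsClosedEmbedding {F G : PreSpace k} (f : F ⟶ G) : Prop :=
  Schematic @IsClosedImmersion f

/-- An étale atlas: a schematic étale surjective morphism from a scheme. -/
structure IsAtlas {U : Sch k} {Z : PreSpace k} (f : yoneda.obj U ⟶ Z) : Prop where
  etale : Schematic @Etale f
  surjective : Schematic @Surjective f

/-- (Quasi-separated) algebraic spaces over `k`: étale sheaves whose diagonal is schematic and
quasi-compact and which admit an étale atlas. -/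
structure IsAlgebraicSpace (Z : PreSpace k) : Prop where
  isSheaf : Presheaf.IsSheaf (Scheme.etaleTopology.over (Spec (CommRingCat.of k))) Z
  diag : Schematic @QuasiCompact (Limits.diag Z)
  exists_atlas : ∃ (U : Sch k) (f : yoneda.obj U ⟶ Z), IsAtlas f

/-- `Z` is of finite type over `k`: it has an étale atlas by a scheme of finite type over `k`. -/
def IsFiniteType (Z : PreSpace k) : Prop :=
  ∃ (U : Sch k) (f : yoneda.obj U ⟶ Z),
    IsAtlas f ∧ LocallyOfFiniteType U.hom ∧ QuasiCompact U.hom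

/-- `Z` is an affine scheme. -/
def IsAffineScheme (Z : PreSpace k) : Prop :=
  ∃ X : Sch k, IsAffine X.left ∧ Nonempty (yoneda.obj X ≅ Z)

/-! ### The underlying topological space of a space -/

/-- A point of `F` with values in a field. -/
structure FieldPoint (F : PreSpace k) : Type (u + 1) where
  /-- the field -/
  K : CommRingCat.{u}
  isField : IsField K
  /-- its structure of an extension of `k` -/
  str : Spec K ⟶ Spec (CommRingCat.of k)
  /-- the point -/
  pt : F.obj (op (Over.mk str))

/-- Two field-valued points become equal over a common field extension. -/
def FieldPoint.Rel {F : PreSpace k} (x y : FieldPoint F) : Prop :=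
  ∃ (L : CommRingCat.{u}) (_ : IsField L) (str : Spec L ⟶ Spec (CommRingCat.of k))
    (a : Over.mk str ⟶ Over.mk x.str) (b : Over.mk str ⟶ Over.mk y.str),
    F.map a.op x.pt = F.map b.op y.pt

/-- The set of points `|F|`: field-valued points modulo field extension. -/
def Points (F : PreSpace k) : Type (u + 1) :=
  Quot (FieldPoint.Rel (F := F))

/-- The map `|S| → |F|` given by a morphism from a scheme `S` to `F`. -/
noncomputable def Points.ofSection {F : PreSpace k} {S : Sch k} (f : F.obj (op S)) (s : S.left) :
    Points F :=
  Quot.mk _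
    { K := S.left.residueField s
      isField := Field.toIsField _
      str := S.left.fromSpecResidueField s ≫ S.hom
      pt := F.map (Over.homMk (S.left.fromSpecResidueField s) :
        Over.mk (S.left.fromSpecResidueField s ≫ S.hom) ⟶ S).op f }

/-- The finest topology for which all maps `|S| → |F|`, with `S` a scheme, are continuous: a subset
of `|F|` is open if and only if its preimage in every `S` is. -/
noncomputable instance (F : PreSpace k) : TopologicalSpace (Points F) :=
  ⨆ (S : Sch k) (f : F.obj (op S)),
    TopologicalSpace.coinduced (Points.ofSection f) inferInstance

/-- The map `|F| → |G|` induced by a morphism. -/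
noncomputable def Points.map {F G : PreSpace k} (f : F ⟶ G) : Points F → Points G :=
  Quot.map (fun x => { K := x.K, isField := x.isField, str := x.str, pt := f.app _ x.pt }) (by
    rintro x y ⟨L, hL, str, a, b, h⟩
    refine ⟨L, hL, str, a, b, ?_⟩
    simp only [← NatTrans.naturality_apply, h])

/-! ### Actions of the multiplicative group -/

/-- An action of the group `𝔾ₘ` on `Z`, on `T`-points, where `𝔾ₘ(T) = Γ(T, 𝒪)ˣ`. -/
structure GmAction (Z : PreSpace k) where
  /-- `act T c z` is `c · z` -/
  act : ∀ T : Sch k, (Γ(T.left, ⊤))ˣ → Z.obj (op T) → Z.obj (op T)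
  one_act : ∀ (T : Sch k) (z : Z.obj (op T)), act T 1 z = z
  mul_act : ∀ (T : Sch k) (c d : (Γ(T.left, ⊤))ˣ) (z : Z.obj (op T)),
    act T (c * d) z = act T c (act T d z)
  map_act : ∀ {T T' : Sch k} (f : T' ⟶ T) (c : (Γ(T.left, ⊤))ˣ) (z : Z.obj (op T)),
    Z.map f.op (act T c z) =
      act T' (Units.map (f.left.appTop.hom : Γ(T.left, ⊤) →* Γ(T'.left, ⊤)) c) (Z.map f.op z)

/-- `Maps(S × X, Z)^{𝔾ₘ}`: the morphism `S × X → Z` corresponding to `f` is equivariant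
(`𝔾ₘ` acts trivially on `S`). -/
def IsEquivariant {X : Sch k} (aX : GmAction (yoneda.obj X)) {Z : PreSpace k} (aZ : GmAction Z)
    {S : Sch k} (f : Z.obj (op (S ⊗ X))) : Prop :=
  ∀ (T : Sch k) (s : T ⟶ S) (x : T ⟶ X) (c : (Γ(T.left, ⊤))ˣ),
    Z.map (lift s (aX.act T c x)).op f = aZ.act T c (Z.map (lift s x).op f)

/-- The space of `𝔾ₘ`-equivariant maps from a scheme `X` to `Z`. -/
noncomputable def GMaps {X : Sch k} (aX : GmAction (yoneda.obj X)) {Z : PreSpace k} (aZ : GmAction Z) :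
    PreSpace k where
  obj S := { f : Z.obj (op (S.unop ⊗ X)) // IsEquivariant aX aZ f }
  map {S S'} g := TypeCat.ofHom fun f => ⟨Z.map (g.unop ▷ X).op f.1, by
    intro T s x c
    have h := f.2 T (s ≫ g.unop) x c
    simp only [← Functor.map_comp_apply, ← op_comp, lift_whiskerRight]
    exact h⟩
  map_id S := by
    ext f
    change Z.map (𝟙 _ ▷ X).op f.1 = f.1
    simp
  map_comp f g := by
    ext x
    change Z.map ((g.unop ≫ f.unop) ▷ X).op x.1 = Z.map _ (Z.map _ x.1)
    simp

/-- Restriction of equivariant maps along an equivariant morphism `h : X → Y` of schemes. -/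
noncomputable def GMaps.precomp {X Y : Sch k} {aX : GmAction (yoneda.obj X)} {aY : GmAction (yoneda.obj Y)}
    (h : X ⟶ Y) (hh : ∀ (T : Sch k) (c : (Γ(T.left, ⊤))ˣ) (x : T ⟶ X),
      (aX.act T c x : T ⟶ X) ≫ h = aY.act T c (x ≫ h))
    {Z : PreSpace k} (aZ : GmAction Z) : GMaps aY aZ ⟶ GMaps aX aZ where
  app S := TypeCat.ofHom fun f => ⟨Z.map (S.unop ◁ h).op f.1, by
    intro T s x c
    have hf := f.2 T s (x ≫ h) c
    simp only [← Functor.map_comp_apply, ← op_comp, lift_whiskerLeft, hh]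
    exact hf⟩
  naturality S S' g := by
    ext f
    apply Subtype.ext
    change Z.map _ (Z.map _ f.1) = Z.map _ (Z.map _ f.1)
    simp only [← Functor.map_comp_apply, ← op_comp, whisker_exchange]

/-- Restriction of equivariant maps `S × X → Z` to `S = S × {x}`, for a `k`-point `x` of `X`. -/
noncomputable def GMaps.eval {X : Sch k} {aX : GmAction (yoneda.obj X)} (x : 𝟙_ (Sch k) ⟶ X)
    {Z : PreSpace k} (aZ : GmAction Z) : GMaps aX aZ ⟶ Z where
  app S := TypeCat.ofHom fun f => Z.map (lift (𝟙 S.unop) (toUnit S.unop ≫ x)).op f.1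
  naturality S S' g := by
    ext f
    change Z.map _ (Z.map _ f.1) = Z.map _ (Z.map _ f.1)
    simp only [← Functor.map_comp_apply, ← op_comp]
    have h : lift (𝟙 S'.unop) (toUnit S'.unop ≫ x) ≫ g.unop ▷ X =
        g.unop ≫ lift (𝟙 S.unop) (toUnit S.unop ≫ x) := by
      ext1 <;> simp
    rw [h]
    rfl

theorem GMaps.precomp_eval {X Y : Sch k} {aX : GmAction (yoneda.obj X)}
    {aY : GmAction (yoneda.obj Y)} (h : X ⟶ Y)
    (hh : ∀ (T : Sch k) (c : (Γ(T.left, ⊤))ˣ) (x : T ⟶ X),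
      (aX.act T c x : T ⟶ X) ≫ h = aY.act T c (x ≫ h))
    {Z : PreSpace k} (aZ : GmAction Z) (x : 𝟙_ (Sch k) ⟶ X) :
    GMaps.precomp h hh aZ ≫ GMaps.eval x aZ = GMaps.eval (x ≫ h) aZ := by
  ext S f
  change Z.map _ (Z.map _ f.1) = Z.map _ f.1
  simp only [← Functor.map_comp_apply, ← op_comp, lift_whiskerLeft, Category.assoc]

/-- The action of `𝔾ₘ` on the point `Spec k`. -/
noncomputable def pointAction (k : Type u) [Field k] : GmAction (yoneda.obj (𝟙_ (Sch k))) where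
  act _ _ z := z
  one_act _ _ := rfl
  mul_act _ _ _ _ := rfl
  map_act _ _ _ := rfl

/-- The affine line over `k`. -/
noncomputable def affineLine (k : Type u) [Field k] : Sch k :=
  Over.mk (𝔸(PUnit.{u + 1}; Spec (CommRingCat.of k)) ↘ Spec (CommRingCat.of k))

/-- The coordinate of a `T`-point of the affine line. -/
noncomputable def coordinate {T : Sch k} (x : T ⟶ affineLine k) : Γ(T.left, ⊤) :=
  x.left.appTop (AffineSpace.coord (Spec (CommRingCat.of k)) PUnit.unit)

/-- The `T`-point of the affine line with a given coordinate. -/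
noncomputable def pointOfCoordinate {T : Sch k} (v : Γ(T.left, ⊤)) : T ⟶ affineLine k :=
  Over.homMk (AffineSpace.homOfVector T.hom fun _ => v) (AffineSpace.homOfVector_over _ _)

theorem coordinate_pointOfCoordinate {T : Sch k} (v : Γ(T.left, ⊤)) :
    coordinate (pointOfCoordinate v) = v :=
  AffineSpace.homOfVector_appTop_coord _ _ _

theorem coordinate_injective {T : Sch k} {x y : T ⟶ affineLine k}
    (h : coordinate x = coordinate y) : x = y := by
  apply Over.OverMorphism.ext
  apply AffineSpace.hom_ext
  · exact (Over.w x).trans (Over.w y).symm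
  · intro _
    exact h

theorem coordinate_comp {T T' : Sch k} (f : T' ⟶ T) (x : T ⟶ affineLine k) :
    coordinate (f ≫ x) = f.left.appTop (coordinate x) := by
  simp only [coordinate, Over.comp_left, Scheme.Hom.comp_appTop]
  rfl

/-- The action of `𝔾ₘ` on the affine line such that `c` multiplies the coordinate by `c ^ n`. -/
noncomputable def lineAction (k : Type u) [Field k] (n : ℤ) :
    GmAction (yoneda.obj (affineLine k)) where
  act T c x := pointOfCoordinate (((c ^ n : (Γ(T.left, ⊤))ˣ) : Γ(T.left, ⊤)) * coordinate x)
  one_act T x := coordinate_injective (by simp [coordinate_pointOfCoordinate])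
  mul_act T c d x := coordinate_injective (by
    simp [coordinate_pointOfCoordinate, mul_zpow, mul_assoc])
  map_act {T T'} f c x := by
    apply coordinate_injective
    change coordinate (f ≫ _) = coordinate (pointOfCoordinate (_ * coordinate (f ≫ _)))
    rw [coordinate_comp, coordinate_pointOfCoordinate, coordinate_pointOfCoordinate,
      coordinate_comp, map_mul, ← map_zpow]
    rfl

/-- The point `1` of the affine line. -/
noncomputable def linePointOne (k : Type u) [Field k] : 𝟙_ (Sch k) ⟶ affineLine k :=
  pointOfCoordinate 1

/-! ### Fixed points, attractors and repellers -/

variable {Z : PreSpace k} (a : GmAction Z)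

/-- The space of fixed points `Z⁰`: equivariant maps from the point. -/
noncomputable def fixedPoints : PreSpace k := GMaps (pointAction k) a

/-- The canonical embedding `Z⁰ → Z`. -/
noncomputable def fixedPointsι : fixedPoints a ⟶ Z := GMaps.eval (𝟙 (𝟙_ (Sch k))) a

/-- The attractor `Z⁺`: equivariant maps from `𝔸¹`, on which `𝔾ₘ` acts by dilations. -/
noncomputable def attractor : PreSpace k := GMaps (lineAction k 1) a

/-- The repeller `Z⁻`: equivariant maps from `𝔸¹₋ = ℙ¹ - {0}`, that is, from the line with
coordinate `t⁻¹`, on which `𝔾ₘ` acts by inverse dilations. -/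
noncomputable def repeller : PreSpace k := GMaps (lineAction k (-1)) a

/-- `p⁺ : Z⁺ → Z`, the value at `1`. -/
noncomputable def pPlus : attractor a ⟶ Z := GMaps.eval (linePointOne k) a

/-- `p⁻ : Z⁻ → Z`, the value at `1`. -/
noncomputable def pMinus : repeller a ⟶ Z := GMaps.eval (linePointOne k) a

/-- `i⁺ : Z⁰ → Z⁺`, induced by `𝔸¹ → pt`. -/
noncomputable def iPlus : fixedPoints a ⟶ attractor a :=
  GMaps.precomp (toUnit (affineLine k)) (fun _ _ _ => toUnit_unique _ _) a

/-- `i⁻ : Z⁰ → Z⁻`, induced by `𝔸¹₋ → pt`. -/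
noncomputable def iMinus : fixedPoints a ⟶ repeller a :=
  GMaps.precomp (toUnit (affineLine k)) (fun _ _ _ => toUnit_unique _ _) a

theorem iPlus_comp_pPlus : iPlus a ≫ pPlus a = fixedPointsι a :=
  (GMaps.precomp_eval _ _ a _).trans (by rw [toUnit_unique (_ ≫ toUnit _) (𝟙 _)]; rfl)

theorem iMinus_comp_pMinus : iMinus a ≫ pMinus a = fixedPointsι a :=
  (GMaps.precomp_eval _ _ a _).trans (by rw [toUnit_unique (_ ≫ toUnit _) (𝟙 _)]; rfl)

/-- `j = (i⁺, i⁻) : Z⁰ → Z⁺ ×_Z Z⁻`. -/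
noncomputable def jMap : fixedPoints a ⟶ pullback (pPlus a) (pMinus a) :=
  pullback.lift (iPlus a) (iMinus a) ((iPlus_comp_pPlus a).trans (iMinus_comp_pMinus a).symm)

end GmSpace

/-!
Let `f : 𝔸¹ → Z` and `f' : 𝔸¹₋ → Z` be equivariant families parametrized by `S` with `f (1) = f' (1)`,
that is, an `S`-point of `Z⁺ ×_Z Z⁻`. It comes from `Z⁰` if and only if both families are constant
(`exists_jMap_eq_iff`), so everything reduces to the locus in `S` where they are constant: it has to be
represented by an open and closed subscheme (`isClopen_constLocus`, `constAlong_iff_range_subset`).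

If `Z = Spec A` is affine, then `f (t) = t · f (1)` and `f' (t) = t⁻¹ · f' (1)`, so the coordinates of
`f (t) = f' (t⁻¹)` are polynomials in `t` and in `t⁻¹`, hence constant, and the locus is all of `S`
(`constAlong_of_lifts`). In general `Z` has only an étale chart `Spec A → Z`, and the argument has three
ingredients.

* *The locus of constancy is closed, and locally defined by finitely many equations*
  (`exists_fg_constAlong_iff`). Étale locally on `S = Spec R`, the family `f` is given by functions
  `g : A → B` on an étale neighbourhood `Spec B → Spec R[X]` of the zero section. Wherever `f` is
  constant, the Taylor coefficients of `g` along the zero section vanish, because étale morphisms are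
  unramified. Conversely, where they vanish, `f` is constant near the zero section by Krull's
  intersection theorem (`taylorIdeal_fg`), and therefore constant, since `𝔾ₘ` moves any point of the
  line towards `0` (`constAlong_of_nhd_zero`). Neither `R` nor `S` is noetherian: the theorem of Krull is
  applied to a model over a finitely generated ring, and finitely many coefficients turn out to suffice.
* *Nilpotent thickenings* (`constAlong_of_nilpotent`). If `f` and `f'` are constant over `R ⧸ I` with `I`
  nilpotent, then there they factor through a chart, and as étale morphisms lift infinitesimally, they do
  so over `R`. The affine argument shows that they are constant over `R`.
* *Idempotents* (`exists_isClopen_constAlong_iff`). If `I` is the finitely generated ideal of the locus of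
  constancy, then the families are constant modulo `I`, hence modulo `I ^ 2`, so `I = I ^ 2`, and
  `I` is generated by an idempotent.

Of the properties of an algebraic space, the proof uses the étale atlas and étale separatedness
(`eq_of_etale_local`).
-/

namespace GmSpace

open Limits MonoidalCategory CartesianMonoidalCategory

variable {k : Type u} [Field k]

/-! ### Taylor expansions along the zero section of an étale neighbourhood -/

section JetAlgebra

open Polynomial

/-- The cotangent space `P ⧸ P ^ 2` is generated by elements of `Λ`: with `Q = P ^ 2 ⊔ (Λ ∩ P) B`,
the projection `B → B ⧸ Q` and `B → B ⧸ P = Λ ⧸ (Λ ∩ P) → B ⧸ Q` agree modulo the square-zero ideal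
`P ⧸ Q`, so they are equal. -/
theorem le_sq_sup_map_comap {Λ B : Type*} [CommRing Λ] [CommRing B] [Algebra Λ B]
    [Algebra.FormallyUnramified Λ B] (P : Ideal B) (hP : ∀ b : B, ∃ c : Λ, b - algebraMap Λ B c ∈ P) :
    P ≤ P ^ 2 ⊔ (P.comap (algebraMap Λ B)).map (algebraMap Λ B) := by
  set J := P.comap (algebraMap Λ B) with hJ
  set Q := P ^ 2 ⊔ J.map (algebraMap Λ B) with hQ
  have hQP : Q ≤ P := sup_le (Ideal.pow_le_self two_ne_zero) Ideal.map_comap_le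
  have hsurj : Function.Surjective (Algebra.ofId Λ (B ⧸ P)) := by
    intro x
    obtain ⟨b, rfl⟩ := Ideal.Quotient.mk_surjective x
    obtain ⟨c, hc⟩ := hP b
    refine ⟨c, ?_⟩
    change Ideal.Quotient.mk P (algebraMap Λ B c) = _
    exact (Ideal.Quotient.eq.mpr hc).symm
  have hker : RingHom.ker (Algebra.ofId Λ (B ⧸ P)) = J := by
    ext c
    change Ideal.Quotient.mk P (algebraMap Λ B c) = 0 ↔ _
    rw [Ideal.Quotient.eq_zero_iff_mem]
    rfl
  let l : (Λ ⧸ RingHom.ker (Algebra.ofId Λ (B ⧸ P))) →ₐ[Λ] B ⧸ Q :=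
    Ideal.Quotient.liftₐ (RingHom.ker (Algebra.ofId Λ (B ⧸ P))) (Algebra.ofId Λ (B ⧸ Q))
      fun c hc => Ideal.Quotient.eq_zero_iff_mem.mpr
        (Ideal.mem_sup_right (Ideal.mem_map_of_mem _ (hker.le hc)))
  let ρ : B →ₐ[Λ] B ⧸ Q :=
    (l.comp (Ideal.quotientKerAlgEquivOfSurjective hsurj).symm.toAlgHom).comp
      (Ideal.Quotient.mkₐ Λ P)
  have hρ : ∀ (b : B) (c : Λ), b - algebraMap Λ B c ∈ P →
      ρ b = Ideal.Quotient.mk Q (algebraMap Λ B c) := by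
    intro b c h
    have h1 : Ideal.Quotient.mkₐ Λ P b = Algebra.ofId Λ (B ⧸ P) c := Ideal.Quotient.eq.mpr h
    have h2 : (Ideal.quotientKerAlgEquivOfSurjective hsurj).symm (Ideal.Quotient.mkₐ Λ P b) =
        Ideal.Quotient.mk _ c := by
      rw [AlgEquiv.symm_apply_eq, h1]
      rfl
    exact (congrArg l h2).trans rfl
  have hnil : IsNilpotent (P.map (Ideal.Quotient.mk Q)) := by
    refine ⟨2, ?_⟩
    rw [← Ideal.map_pow, Ideal.zero_eq_bot, Ideal.map_eq_bot_iff_le_ker, Ideal.mk_ker]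
    exact le_sup_left
  have heq : ρ = Ideal.Quotient.mkₐ Λ Q := by
    refine Algebra.FormallyUnramified.ext (R := Λ) (A := B) (B := B ⧸ Q) _ hnil fun b => ?_
    obtain ⟨c, hc⟩ := hP b
    rw [hρ b c hc]
    change Ideal.Quotient.mk _ (Ideal.Quotient.mk Q (algebraMap Λ B c)) =
      Ideal.Quotient.mk _ (Ideal.Quotient.mk Q b)
    rw [eq_comm, Ideal.Quotient.eq, ← map_sub]
    exact Ideal.mem_map_of_mem _ hc
  intro b hb
  have h0 : ρ b = 0 := by rw [hρ b 0 (by simpa using hb)]; simp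
  rw [heq] at h0
  exact Ideal.Quotient.eq_zero_iff_mem.mp h0

/-- If `B` is formally unramified over `Λ` and `Λ → B ⧸ P` is surjective, then so is
`Λ → B ⧸ P ^ n`: the cotangent space `P ⧸ P ^ 2` is generated by `Λ ∩ P`. -/
theorem exists_sub_algebraMap_mem_pow {Λ B : Type*} [CommRing Λ] [CommRing B] [Algebra Λ B]
    [Algebra.FormallyUnramified Λ B] (P : Ideal B) (hP : ∀ b : B, ∃ c : Λ, b - algebraMap Λ B c ∈ P)
    (n : ℕ) (b : B) : ∃ c : Λ, b - algebraMap Λ B c ∈ P ^ n := by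
  set J := P.comap (algebraMap Λ B) with hJ
  have hJP : J.map (algebraMap Λ B) ≤ P := Ideal.map_comap_le
  have key : ∀ n : ℕ, P ^ n ≤ P ^ (n + 1) ⊔ (J ^ n).map (algebraMap Λ B) := by
    intro n
    induction n with
    | zero => simp [Ideal.map_top]
    | succ n ih =>
      calc P ^ (n + 1) = P ^ n * P := pow_succ _ _
        _ ≤ (P ^ (n + 1) ⊔ (J ^ n).map (algebraMap Λ B)) *
            (P ^ 2 ⊔ J.map (algebraMap Λ B)) :=
          Ideal.mul_mono ih (le_sq_sup_map_comap P hP)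
        _ ≤ _ := by
          rw [Ideal.sup_mul, Ideal.mul_sup, Ideal.mul_sup, ← Ideal.map_mul, ← pow_succ]
          have h1 : P ^ (n + 1) * P ^ 2 ≤ P ^ (n + 1 + 1) := by
            rw [← pow_add]; exact Ideal.pow_le_pow_right (by omega)
          have h2 : P ^ (n + 1) * J.map (algebraMap Λ B) ≤ P ^ (n + 1 + 1) := by
            rw [pow_succ P (n + 1)]; exact Ideal.mul_mono le_rfl hJP
          have h3 : (J ^ n).map (algebraMap Λ B) * P ^ 2 ≤ P ^ (n + 1 + 1) := by
            rw [show n + 1 + 1 = n + 2 by ring, pow_add, Ideal.map_pow]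
            exact Ideal.mul_mono (Ideal.pow_right_mono hJP n) le_rfl
          exact sup_le (sup_le (h1.trans le_sup_left) (h2.trans le_sup_left))
            (sup_le (h3.trans le_sup_left) le_sup_right)
  -- elements of `J ^ n B` are congruent to elements of `Λ` modulo `P ^ (n + 1)`
  have hmap : ∀ n : ℕ, ∀ x ∈ (J ^ n).map (algebraMap Λ B),
      ∃ c ∈ J ^ n, x - algebraMap Λ B c ∈ P ^ (n + 1) := by
    intro n x hx
    refine Submodule.span_induction ?_ ⟨0, zero_mem _, by simp⟩ ?_ ?_ hx
    · rintro _ ⟨c, hc, rfl⟩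
      exact ⟨c, hc, by simp⟩
    · rintro x y - - ⟨c, hc, hc'⟩ ⟨d, hd, hd'⟩
      exact ⟨c + d, add_mem hc hd, by rw [map_add, add_sub_add_comm]; exact add_mem hc' hd'⟩
    · rintro y x - ⟨c, hc, hc'⟩
      obtain ⟨e, he⟩ := hP y
      refine ⟨e * c, Ideal.mul_mem_left _ _ hc, ?_⟩
      have h1 : algebraMap Λ B c ∈ P ^ n := by
        have := Ideal.mem_map_of_mem (algebraMap Λ B) hc
        rw [Ideal.map_pow] at this
        exact Ideal.pow_right_mono hJP n this
      have h2 : y • x - algebraMap Λ B (e * c) =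
          y * (x - algebraMap Λ B c) + algebraMap Λ B c * (y - algebraMap Λ B e) := by
        rw [map_mul, smul_eq_mul]; ring
      rw [h2]
      exact add_mem (Ideal.mul_mem_left _ _ hc') (Ideal.mul_mem_mul h1 he)
  induction n with
  | zero => exact ⟨0, by simp⟩
  | succ n ih =>
    obtain ⟨c, hc⟩ := ih
    obtain ⟨x, hx, y, hy, hxy⟩ := Submodule.mem_sup.mp (key n hc)
    obtain ⟨d, -, hd⟩ := hmap n y hy
    refine ⟨c + d, ?_⟩
    have : b - algebraMap Λ B (c + d) = x + (y - algebraMap Λ B d) := by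
      rw [map_add]; linear_combination -hxy
    rw [this]
    exact add_mem hx hd

variable {R B : Type u} [CommRing R] [CommRing B] [Algebra R[X] B]

theorem sub_algebraMap_C_mem_ker (σ : B →+* R) (hσ : ∀ p, σ (algebraMap R[X] B p) = p.coeff 0)
    (b : B) : b - algebraMap R[X] B (C (σ b)) ∈ RingHom.ker σ := by
  rw [RingHom.mem_ker, map_sub, hσ, coeff_C_zero, sub_self]

/-- A section `σ` over the zero section of a smooth algebra `B` over `R[X]` extends to all
infinitesimal neighbourhoods of the zero section. -/
theorem exists_jet [Algebra.FormallySmooth R[X] B] (σ : B →+* R)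
    (hσ : ∀ p, σ (algebraMap R[X] B p) = p.coeff 0) (n : ℕ) :
    ∃ ψ : B →ₐ[R[X]] R[X] ⧸ Ideal.span {(X : R[X]) ^ (n + 1)},
      ∀ b p, ψ b = Ideal.Quotient.mk _ p → σ b = p.coeff 0 := by
  set P := RingHom.ker σ with hP
  let g : (R[X] ⧸ Ideal.span {(X : R[X]) ^ (n + 1)}) →ₐ[R[X]] B ⧸ P :=
    Ideal.Quotient.liftₐ _ (Algebra.ofId R[X] (B ⧸ P)) (by
      intro p hp
      rw [Ideal.mem_span_singleton] at hp
      change Ideal.Quotient.mk P (algebraMap R[X] B p) = 0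
      rw [Ideal.Quotient.eq_zero_iff_mem, hP, RingHom.mem_ker, hσ]
      exact X_pow_dvd_iff.mp hp 0 (by omega))
  have hg : ∀ p, g (Ideal.Quotient.mk _ p) = Ideal.Quotient.mk P (algebraMap R[X] B p) :=
    fun p => rfl
  have hsurj : Function.Surjective g := by
    intro x
    obtain ⟨b, rfl⟩ := Ideal.Quotient.mk_surjective x
    refine ⟨Ideal.Quotient.mk _ (C (σ b)), ?_⟩
    rw [hg, eq_comm, Ideal.Quotient.eq]
    exact sub_algebraMap_C_mem_ker σ hσ b
  have hker : IsNilpotent (RingHom.ker g) := by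
    refine ⟨n + 1, ?_⟩
    have : RingHom.ker g ≤
        (Ideal.span {(X : R[X])}).map (Ideal.Quotient.mk (Ideal.span {(X : R[X]) ^ (n + 1)})) := by
      intro x hx
      obtain ⟨p, rfl⟩ := Ideal.Quotient.mk_surjective x
      apply Ideal.mem_map_of_mem
      have h1 : Ideal.Quotient.mk P (algebraMap R[X] B p) = 0 := hx
      rw [Ideal.Quotient.eq_zero_iff_mem, hP, RingHom.mem_ker, hσ] at h1
      rw [Ideal.mem_span_singleton]
      exact X_dvd_iff.mpr h1
    refine le_antisymm ((Ideal.pow_right_mono this _).trans ?_) bot_le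
    rw [← Ideal.map_pow, Ideal.span_singleton_pow]
    exact le_of_eq (Ideal.map_quotient_self _)
  refine ⟨Algebra.FormallySmooth.liftOfSurjective (Ideal.Quotient.mkₐ R[X] P) g hsurj hker, ?_⟩
  intro b p h
  have h1 := Algebra.FormallySmooth.liftOfSurjective_apply (Ideal.Quotient.mkₐ R[X] P) g hsurj hker b
  rw [h, hg] at h1
  have h2 : b - algebraMap R[X] B p ∈ P := Ideal.Quotient.eq.mp h1.symm
  rw [hP, RingHom.mem_ker, map_sub, hσ, sub_eq_zero] at h2
  exact h2

/-- The `n`-jet along the section vanishes on `(ker σ) ^ (n + 1)`. -/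
theorem jet_eq_zero (σ : B →+* R) {n : ℕ}
    (ψ : B →ₐ[R[X]] R[X] ⧸ Ideal.span {(X : R[X]) ^ (n + 1)})
    (hψ : ∀ b p, ψ b = Ideal.Quotient.mk _ p → σ b = p.coeff 0) {b : B}
    (hb : b ∈ RingHom.ker σ ^ (n + 1)) : ψ b = 0 := by
  have h1 : (RingHom.ker σ).map ψ ≤ (Ideal.span {(X : R[X])}).map
      (Ideal.Quotient.mk (Ideal.span {(X : R[X]) ^ (n + 1)})) := by
    rw [Ideal.map_le_iff_le_comap]
    intro x hx
    obtain ⟨p, hp⟩ := Ideal.Quotient.mk_surjective (ψ x)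
    rw [Ideal.mem_comap, ← hp]
    apply Ideal.mem_map_of_mem
    rw [Ideal.mem_span_singleton]
    exact X_dvd_iff.mpr ((hψ x p hp.symm).symm.trans hx)
  have h2 := Ideal.pow_right_mono h1 (n + 1)
  rw [← Ideal.map_pow, ← Ideal.map_pow, Ideal.span_singleton_pow, Ideal.map_quotient_self] at h2
  exact h2 (Ideal.mem_map_of_mem ψ hb)

/-- Taylor expansions along the section are unique. -/
theorem X_pow_dvd_of_algebraMap_mem_pow [Algebra.FormallySmooth R[X] B] (σ : B →+* R)
    (hσ : ∀ p, σ (algebraMap R[X] B p) = p.coeff 0) {n : ℕ} {p : R[X]}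
    (hp : algebraMap R[X] B p ∈ RingHom.ker σ ^ n) : X ^ n ∣ p := by
  cases n with
  | zero => simp
  | succ n =>
    obtain ⟨ψ, hψ⟩ := exists_jet σ hσ n
    have h := jet_eq_zero σ ψ hψ hp
    rw [AlgHom.commutes] at h
    exact Ideal.mem_span_singleton.mp (Ideal.Quotient.eq_zero_iff_mem.mp h)

/-- A version of `exists_mul_mem_map_of_jets` in the presence of a noetherian model `T` of `B`, over the
ring `Rx` of polynomials with coefficients in a subring `R₀`. The Taylor polynomials of an element of `T`
can be chosen in `Rx`, so Krull's theorem applies to `T ⧸ K`, with `K` the preimage of `I B`. -/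
theorem exists_mul_mem_map_of_jets_aux [Algebra.Etale R[X] B] (σ : B →+* R)
    (hσ : ∀ p, σ (algebraMap R[X] B p) = p.coeff 0) (I : Ideal R) (b : B)
    (hb : ∀ n : ℕ, ∃ p : R[X], b - algebraMap R[X] B p ∈ RingHom.ker σ ^ n ∧
      ∀ m < n, p.coeff m ∈ I)
    (R₀ : Subring R) (Rx : Subring R[X]) (hRx : ∀ p : R[X], p ∈ Rx ↔ ∀ n, p.coeff n ∈ R₀)
    {T : Type u} [CommRing T] [Algebra Rx T] [Algebra.FormallyUnramified Rx T] [IsNoetherianRing T]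
    (θ : T →ₐ[Rx] B) (hθR : ∀ x, σ (θ x) ∈ R₀) (b₁ : T) (hb₁ : θ b₁ = b) :
    ∃ h : B, σ h = 1 ∧ h * b ∈ I.map ((algebraMap R[X] B).comp C) := by
  classical
  set P := RingHom.ker σ with hP
  set IB := I.map ((algebraMap R[X] B).comp C) with hIB
  set P₁ := P.comap θ with hP₁
  have hs : ∀ x : T, ∃ c : Rx, x - algebraMap Rx _ c ∈ P₁ := by
    intro x
    refine ⟨⟨C (σ (θ x)), (hRx _).mpr fun n => ?_⟩, ?_⟩
    · rw [coeff_C]; split_ifs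
      · exact hθR x
      · exact zero_mem _
    · rw [hP₁, Ideal.mem_comap, map_sub, AlgHom.commutes]
      exact sub_algebraMap_C_mem_ker σ hσ (θ x)
  set K := IB.comap θ with hK
  -- the part of degree `< n` of a Taylor polynomial of `b₁` lies in `K`, the rest in `P₁ ^ n`
  have hmem : ∀ n, b₁ ∈ K ⊔ P₁ ^ n := by
    intro n
    obtain ⟨c, hc⟩ := exists_sub_algebraMap_mem_pow P₁ hs n b₁
    obtain ⟨p, hp, hpI⟩ := hb n
    have h1 : b - algebraMap R[X] B c ∈ P ^ n := by
      have := Ideal.le_comap_pow θ n hc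
      rw [Ideal.mem_comap, map_sub, hb₁, AlgHom.commutes] at this
      exact this
    have h2 : X ^ n ∣ p - (c : R[X]) := by
      apply X_pow_dvd_of_algebraMap_mem_pow σ hσ
      have := sub_mem h1 hp
      rw [sub_sub_sub_cancel_left, ← map_sub] at this
      exact this
    have hcI : ∀ m < n, (c : R[X]).coeff m ∈ I := by
      intro m hm
      have := X_pow_dvd_iff.mp h2 m hm
      rw [coeff_sub, sub_eq_zero] at this
      rw [← this]; exact hpI m hm
    let low : R[X] := ∑ m ∈ Finset.range n, C ((c : R[X]).coeff m) * X ^ m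
    have hlow : ∀ m, low.coeff m = if m < n then (c : R[X]).coeff m else 0 := by
      intro m
      simp only [low, finsetSum_coeff, coeff_C_mul_X_pow]
      rw [Finset.sum_ite_eq]
      simp
    have hlowx : low ∈ Rx := by
      rw [hRx]; intro m; rw [hlow]
      split_ifs
      · exact (hRx _).mp c.2 m
      · exact zero_mem _
    have h3 : X ^ n ∣ (c : R[X]) - low := by
      rw [X_pow_dvd_iff]; intro m hm
      rw [coeff_sub, hlow, if_pos hm, sub_self]
    obtain ⟨r, hr⟩ := h3
    have hrx : r ∈ Rx := by
      rw [hRx]; intro m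
      have := congrArg (fun q => q.coeff (m + n)) hr
      simp only [coeff_X_pow_mul] at this
      rw [← this]
      exact (hRx _).mp (sub_mem c.2 hlowx) _
    have hXx : (X : R[X]) ∈ Rx := by
      rw [hRx]; intro m; rw [coeff_X]; split_ifs
      · exact one_mem _
      · exact zero_mem _
    have hX : algebraMap Rx T ⟨X, hXx⟩ ∈ P₁ := by
      rw [hP₁, Ideal.mem_comap, AlgHom.commutes]
      change σ (algebraMap R[X] B X) = 0
      rw [hσ, coeff_X_zero]
    have hlowK : algebraMap Rx T ⟨low, hlowx⟩ ∈ K := by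
      rw [hK, Ideal.mem_comap, AlgHom.commutes]
      change algebraMap R[X] B low ∈ IB
      rw [map_sum]
      refine sum_mem fun m hm => ?_
      rw [map_mul]
      exact Ideal.mul_mem_right _ _
        (Ideal.mem_map_of_mem ((algebraMap R[X] B).comp C) (hcI m (Finset.mem_range.mp hm)))
    have hsplit : c = ⟨low, hlowx⟩ + ⟨X, hXx⟩ ^ n * ⟨r, hrx⟩ :=
      Subtype.ext (by
        change (c : R[X]) = low + X ^ n * r
        rw [← hr]; ring)
    have h4 : b₁ = algebraMap Rx _ ⟨low, hlowx⟩ +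
        ((b₁ - algebraMap Rx _ c) + algebraMap Rx _ ⟨X, hXx⟩ ^ n * algebraMap Rx _ ⟨r, hrx⟩) := by
      conv_rhs => rw [hsplit]
      simp only [map_add, map_mul, map_pow]
      ring
    rw [h4]
    exact Submodule.add_mem_sup hlowK
      (add_mem hc (Ideal.mul_mem_right _ _ (Ideal.pow_mem_pow hX n)))
  obtain ⟨⟨r, hr⟩, hrb⟩ := (Ideal.mem_iInf_smul_pow_eq_bot_iff P₁ (Ideal.Quotient.mk K b₁)).mp (by
    rw [Submodule.mem_iInf]
    intro n
    obtain ⟨x, hx, y, hy, hxy⟩ := Submodule.mem_sup.mp (hmem n)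
    have : Ideal.Quotient.mk K b₁ = y • (1 : T ⧸ K) := by
      rw [← hxy, map_add, Ideal.Quotient.eq_zero_iff_mem.mpr hx, zero_add, Algebra.smul_def,
        mul_one]
      rfl
    rw [this]
    exact Submodule.smul_mem_smul hy trivial)
  refine ⟨θ (1 - r), ?_, ?_⟩
  · have : σ (θ r) = 0 := hr
    rw [map_sub, map_sub, map_one, map_one, this, sub_zero]
  · have h5 : (1 - r) * b₁ ∈ K := by
      rw [← Ideal.Quotient.eq_zero_iff_mem, sub_mul, one_mul, map_sub, map_mul, sub_eq_zero]
      exact hrb.symm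
    rw [hK, Ideal.mem_comap, map_mul, hb₁] at h5
    exact h5

open TensorProduct in
/-- Relative form of Krull's intersection theorem: an element all of whose Taylor coefficients along
the section `σ` lie in the ideal `I` lies in `I B` on a neighbourhood of the section. -/
theorem exists_mul_mem_map_of_jets [Algebra.Etale R[X] B] (σ : B →+* R)
    (hσ : ∀ p, σ (algebraMap R[X] B p) = p.coeff 0) (I : Ideal R) (b : B)
    (hb : ∀ n : ℕ, ∃ p : R[X], b - algebraMap R[X] B p ∈ RingHom.ker σ ^ n ∧
      ∀ m < n, p.coeff m ∈ I) :
    ∃ h : B, σ h = 1 ∧ h * b ∈ I.map ((algebraMap R[X] B).comp C) := by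
  classical
  obtain ⟨A₀, B₀, _, _, ⟨S, hS⟩, hEt, ⟨e⟩⟩ := Algebra.Etale.exists_subalgebra_fg ℤ R[X] B
  let τ : B₀ →ₐ[A₀] B :=
    { (e.symm.toAlgHom : (R[X] ⊗[A₀] B₀) →+* B).comp
        (Algebra.TensorProduct.includeRight : B₀ →ₐ[A₀] R[X] ⊗[A₀] B₀).toRingHom with
      commutes' := fun a => by
        change e.symm (1 ⊗ₜ algebraMap A₀ B₀ a) = algebraMap R[X] B (algebraMap A₀ R[X] a)
        rw [← Algebra.TensorProduct.algebraMap_apply', Algebra.TensorProduct.algebraMap_apply,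
          ← AlgEquiv.commutes e.symm]
        rfl }
  have hτ : ∀ (p : R[X]) (y : B₀), e.symm (p ⊗ₜ y) = algebraMap R[X] B p * τ y := by
    intro p y
    have : (p ⊗ₜ[A₀] y : R[X] ⊗[A₀] B₀) = p • (1 ⊗ₜ y) := by
      rw [TensorProduct.smul_tmul', smul_eq_mul, mul_one]
    rw [this, map_smul, Algebra.smul_def]
    rfl
  obtain ⟨S', hS'⟩ := (inferInstance : Algebra.FiniteType A₀ B₀).out
  obtain ⟨F, hF⟩ := TensorProduct.exists_finset (e b)
  -- a finitely generated subring of `R` over which everything in sight is defined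
  let G : Set R := (⋃ p ∈ S, (p.coeffs : Set R)) ∪ (⋃ x ∈ F, (x.1.coeffs : Set R)) ∪
    (fun y => σ (τ y)) '' S'
  have hG : G.Finite := ((S.finite_toSet.biUnion fun p _ => p.coeffs.finite_toSet).union
    (F.finite_toSet.biUnion fun p _ => p.1.coeffs.finite_toSet)).union (S'.finite_toSet.image _)
  let R₀ : Subalgebra ℤ R := Algebra.adjoin ℤ G
  have hGR : G ⊆ R₀ := Algebra.subset_adjoin
  have : IsNoetherianRing R₀ :=
    isNoetherianRing_of_fg ⟨hG.toFinset, by rw [Set.Finite.coe_toFinset]⟩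
  let Rx : Subalgebra ℤ R[X] := (mapAlgHom R₀.val).range
  have : IsNoetherianRing Rx :=
    isNoetherianRing_of_surjective R₀[X] Rx (mapAlgHom R₀.val).rangeRestrict.toRingHom
      (mapAlgHom R₀.val).rangeRestrict_surjective
  have hRx : ∀ p : R[X], p ∈ Rx ↔ ∀ n, p.coeff n ∈ R₀ := by
    intro p
    constructor
    · rintro ⟨q, rfl⟩ n
      change (Polynomial.map _ q).coeff n ∈ R₀
      rw [coeff_map]
      exact (q.coeff n).2
    · intro h
      have : p ∈ lifts (R₀.val : R₀ →+* R) := by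
        rw [lifts_iff_coeff_lifts]
        exact fun n => ⟨⟨_, h n⟩, rfl⟩
      obtain ⟨q, hq⟩ := this
      exact ⟨q, hq⟩
  have hcoeffs : ∀ p : R[X], (p.coeffs : Set R) ⊆ R₀ → p ∈ Rx := by
    intro p h
    rw [hRx]
    intro n
    by_cases hn : p.coeff n = 0
    · rw [hn]; exact zero_mem _
    · exact h (coeff_mem_coeffs hn)
  have hA : A₀ ≤ Rx := by
    rw [← hS]
    refine Algebra.adjoin_le fun p hp => hcoeffs p fun r hr => hGR ?_
    exact Or.inl (Or.inl (Set.mem_biUnion hp hr))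
  have hFx : ∀ x ∈ F, x.1 ∈ Rx := by
    intro x hx
    refine hcoeffs _ fun r hr => hGR ?_
    exact Or.inl (Or.inr (Set.mem_biUnion hx hr))
  let : Algebra A₀ Rx := (Subalgebra.inclusion hA).toAlgebra
  have : IsScalarTower A₀ Rx B := IsScalarTower.of_algebraMap_eq fun _ => rfl
  let θ : Rx ⊗[A₀] B₀ →ₐ[Rx] B :=
    Algebra.TensorProduct.lift (Algebra.ofId Rx B) τ fun _ _ => Commute.all _ _
  have hθ : ∀ (p : Rx) (y : B₀), θ (p ⊗ₜ y) = algebraMap R[X] B p * τ y := fun p y => rfl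
  have : IsNoetherianRing (Rx ⊗[A₀] B₀) :=
    @Algebra.FiniteType.isNoetherianRing Rx (Rx ⊗[A₀] B₀) _ _ _ _ _
  have hσx : ∀ p : Rx, σ (algebraMap R[X] B p) ∈ R₀ := fun p => by
    rw [hσ]; exact (hRx p).mp p.2 0
  have hτR : ∀ y : B₀, σ (τ y) ∈ R₀ := by
    intro y
    have hy : y ∈ Algebra.adjoin A₀ (S' : Set B₀) := by rw [hS']; trivial
    refine Algebra.adjoin_induction ?_ ?_ ?_ ?_ hy
    · intro x hx
      exact hGR (Or.inr ⟨x, hx, rfl⟩)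
    · intro r
      rw [AlgHom.commutes]
      exact hσx ⟨r, hA r.2⟩
    · intro x y _ _ hx hy
      rw [map_add, map_add]; exact add_mem hx hy
    · intro x y _ _ hx hy
      rw [map_mul, map_mul]; exact mul_mem hx hy
  have hθR : ∀ x : Rx ⊗[A₀] B₀, σ (θ x) ∈ R₀ := by
    intro x
    induction x with
    | zero => rw [map_zero, map_zero]; exact zero_mem _
    | tmul p y => rw [hθ, map_mul]; exact mul_mem (hσx p) (hτR y)
    | add x y hx hy => rw [map_add, map_add]; exact add_mem hx hy
  let b₁ : Rx ⊗[A₀] B₀ := ∑ x ∈ F.attach, (⟨x.1.1, hFx x.1 x.2⟩ : Rx) ⊗ₜ x.1.2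
  have hb₁ : θ b₁ = b := by
    rw [map_sum, ← e.symm_apply_apply b, hF, map_sum, ← Finset.sum_attach F]
    exact Finset.sum_congr rfl fun x _ => (hθ _ _).trans (hτ _ _).symm
  exact exists_mul_mem_map_of_jets_aux σ hσ I b hb R₀.toSubring Rx.toSubring hRx
    (T := Rx ⊗[A₀] B₀) θ hθR b₁ hb₁

/-- The ideal of `R` generated by the Taylor coefficients, along the section `σ`, of the elements
`b i` of an étale `R[X]`-algebra. -/
def taylorIdeal (σ : B →+* R) {ι : Type*} (b : ι → B) : Ideal R :=
  Ideal.span {c | ∃ (i : ι) (n m : ℕ) (p : R[X]),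
    m < n ∧ b i - algebraMap R[X] B p ∈ RingHom.ker σ ^ n ∧ c = p.coeff m}

/-- Membership in an extended ideal involves only finitely many of its elements. -/
theorem exists_fg_le_mem_map {R B : Type*} [CommRing R] [CommRing B] (f : R →+* B) (I : Ideal R)
    {x : B} (hx : x ∈ I.map f) : ∃ I' ≤ I, I'.FG ∧ x ∈ I'.map f := by
  refine Submodule.span_induction ?_ ?_ ?_ ?_ hx
  · rintro _ ⟨c, hc, rfl⟩
    exact ⟨Ideal.span {c}, (Ideal.span_singleton_le_iff_mem _).mpr hc,
      ⟨{c}, by simp [Ideal.span]⟩, Ideal.mem_map_of_mem _ (Ideal.mem_span_singleton_self c)⟩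
  · exact ⟨⊥, bot_le, Submodule.fg_bot, zero_mem _⟩
  · rintro x y - - ⟨I₁, h₁, hf₁, hx⟩ ⟨I₂, h₂, hf₂, hy⟩
    exact ⟨I₁ ⊔ I₂, sup_le h₁ h₂, Submodule.FG.sup hf₁ hf₂,
      add_mem (Ideal.map_mono le_sup_left hx) (Ideal.map_mono le_sup_right hy)⟩
  · rintro c x - ⟨I₁, h₁, hf₁, hx⟩
    exact ⟨I₁, h₁, hf₁, Ideal.mul_mem_left _ _ hx⟩

theorem coeff_mem_of_mul_coeff_mem (I : Ideal R) {n : ℕ} (q p : R[X]) (hq : q.coeff 0 = 1)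
    (h : ∀ m < n, (q * p).coeff m ∈ I) : ∀ m < n, p.coeff m ∈ I := by
  intro m
  induction m using Nat.strong_induction_on with
  | _ m ih =>
    intro hm
    have h1 := h m hm
    rw [coeff_mul, Finset.Nat.sum_antidiagonal_eq_sum_range_succ_mk, Finset.sum_range_succ',
      hq, one_mul] at h1
    refine (Submodule.add_mem_iff_right I (sum_mem fun j hj => ?_)).mp h1
    rw [Finset.mem_range] at hj
    exact Ideal.mul_mem_left _ _ (ih _ (by simp; omega) (by simp; omega))

/-- Only finitely many Taylor coefficients matter: where all of them vanish, the `b i` vanish in a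
neighbourhood of the section, by Krull's intersection theorem, and this happens already where
finitely many of them vanish. -/
theorem taylorIdeal_fg [Algebra.Etale R[X] B] (σ : B →+* R)
    (hσ : ∀ p, σ (algebraMap R[X] B p) = p.coeff 0) {ι : Type*} [Finite ι] (b : ι → B) :
    (taylorIdeal σ b).FG ∧ ∃ h : B, σ h = 1 ∧
      ∀ i, h * b i ∈ (taylorIdeal σ b).map ((algebraMap R[X] B).comp C) := by
  classical
  cases nonempty_fintype ι
  set I := taylorIdeal σ b with hI
  set P := RingHom.ker σ with hP
  have h1 : ∀ i, ∃ h : B, σ h = 1 ∧ h * b i ∈ I.map ((algebraMap R[X] B).comp C) := by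
    intro i
    refine exists_mul_mem_map_of_jets σ hσ I (b i) fun n => ?_
    obtain ⟨p, hp⟩ := exists_sub_algebraMap_mem_pow P
      (fun x => ⟨_, sub_algebraMap_C_mem_ker σ hσ x⟩) n (b i)
    exact ⟨p, hp, fun m hm => Ideal.subset_span ⟨i, n, m, p, hm, hp, rfl⟩⟩
  choose h hσh hhb using h1
  have h2 : ∃ h : B, σ h = 1 ∧ ∀ i, h * b i ∈ I.map ((algebraMap R[X] B).comp C) := by
    refine ⟨∏ i, h i, by rw [map_prod]; exact Finset.prod_eq_one fun i _ => hσh i, fun i => ?_⟩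
    obtain ⟨c, hc⟩ := Finset.dvd_prod_of_mem h (Finset.mem_univ i)
    rw [hc, mul_comm (h i) c, mul_assoc]
    exact Ideal.mul_mem_left _ _ (hhb i)
  refine ⟨?_, h2⟩
  obtain ⟨h, hσh, hhb⟩ := h2
  choose I' hI' hfg hmem using fun i => exists_fg_le_mem_map _ I (hhb i)
  have hle : I ≤ ⨆ i, I' i := by
    refine Ideal.span_le.mpr ?_
    rintro _ ⟨i, n, m, p, hm, hp, rfl⟩
    refine Ideal.mem_iSup_of_mem i ?_
    -- modulo the `n`-th power of the kernel, elements of `I' i B` are polynomials over `I' i`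
    have h3 : ∀ x ∈ (I' i).map ((algebraMap R[X] B).comp C),
        ∃ r : R[X], (∀ m, r.coeff m ∈ I' i) ∧ x - algebraMap R[X] B r ∈ P ^ n := by
      intro x hx
      refine Submodule.span_induction ?_ ?_ ?_ ?_ hx
      · rintro _ ⟨c, hc, rfl⟩
        refine ⟨C c, fun m => ?_, by simp⟩
        rw [coeff_C]; split_ifs
        · exact hc
        · exact zero_mem _
      · exact ⟨0, fun m => by simp, by simp⟩
      · rintro x y - - ⟨r, hr, hr'⟩ ⟨s, hs, hs'⟩
        exact ⟨r + s, fun m => by rw [coeff_add]; exact add_mem (hr m) (hs m),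
          by rw [map_add, add_sub_add_comm]; exact add_mem hr' hs'⟩
      · rintro y x - ⟨r, hr, hr'⟩
        obtain ⟨s, hs⟩ := exists_sub_algebraMap_mem_pow P
          (fun x => ⟨_, sub_algebraMap_C_mem_ker σ hσ x⟩) n y
        refine ⟨s * r, fun m => ?_, ?_⟩
        · rw [coeff_mul]
          exact sum_mem fun x _ => Ideal.mul_mem_left _ _ (hr _)
        · have : y • x - algebraMap R[X] B (s * r) =
              y * (x - algebraMap R[X] B r) + algebraMap R[X] B r * (y - algebraMap R[X] B s) := by
            rw [map_mul, smul_eq_mul]; ring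
          rw [this]
          exact add_mem (Ideal.mul_mem_left _ _ hr') (Ideal.mul_mem_left _ _ hs)
    obtain ⟨r, hr, hr'⟩ := h3 _ (hmem i)
    obtain ⟨q, hq⟩ := exists_sub_algebraMap_mem_pow P
      (fun x => ⟨_, sub_algebraMap_C_mem_ker σ hσ x⟩) n h
    have hq0 : q.coeff 0 = 1 := by
      have h4 : h - algebraMap R[X] B q ∈ P := Ideal.pow_le_self (by omega) hq
      rw [hP, RingHom.mem_ker, map_sub, hσ, hσh, sub_eq_zero] at h4
      exact h4.symm
    have h5 : X ^ n ∣ r - q * p := by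
      apply X_pow_dvd_of_algebraMap_mem_pow σ hσ
      have : algebraMap R[X] B (r - q * p) = (h - algebraMap R[X] B q) * b i +
          algebraMap R[X] B q * (b i - algebraMap R[X] B p) - (h * b i - algebraMap R[X] B r) := by
        rw [map_sub, map_mul]; ring
      rw [this]
      exact sub_mem (add_mem (Ideal.mul_mem_right _ _ hq) (Ideal.mul_mem_left _ _ hp)) hr'
    refine coeff_mem_of_mul_coeff_mem (n := n) (I' i) q p hq0 (fun m hm => ?_) m hm
    have h6 := X_pow_dvd_iff.mp h5 m hm
    rw [coeff_sub, sub_eq_zero] at h6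
    rw [← h6]; exact hr m
  rw [le_antisymm hle (iSup_le hI')]
  exact Submodule.fg_iSup _ hfg

end JetAlgebra

/-! ### Étale separatedness -/

/-- Sections of an étale sheaf which agree étale locally are equal. -/
theorem eq_of_etale_local {Z : PreSpace k}
    (hZ : Presheaf.IsSheaf (Scheme.etaleTopology.over (Spec (CommRingCat.of k))) Z)
    {T : Sch k} (x y : Z.obj (op T))
    (h : ∀ t : T.left, ∃ (T' : Sch k) (f : T' ⟶ T), Etale f.left ∧ t ∈ Set.range f.left ∧
      Z.map f.op x = Z.map f.op y) : x = y := by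
  choose T' f hf hmem heq using h
  choose t' ht' using hmem
  let 𝒰 : Scheme.Cover.{u} (Scheme.precoverage @Etale) T.left :=
    Scheme.Cover.mkOfCovers T.left (fun t => (T' t).left) (fun t => (f t).left)
      (fun t => ⟨t, t' t, ht' t⟩) hf
  have hcov : Sieve.ofArrows T' f ∈ Scheme.etaleTopology.over (Spec (CommRingCat.of k)) T := by
    rw [GrothendieckTopology.mem_over_iff, Sieve.overEquiv_ofArrows]
    exact 𝒰.mem_grothendieckTopology
  refine ((isSheaf_iff_isSheaf_of_type _ _).mp hZ _ hcov).isSeparatedFor.ext ?_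
  rintro Y g ⟨W, a, b, ⟨t⟩, rfl⟩
  rw [op_comp, Functor.map_comp_apply, Functor.map_comp_apply, heq t]

/-- Points of `T` and `T'` over the same point of `S` lift to a point of a fibre product. -/
theorem exists_etale_pullback {T T' S : Sch k} (q : T ⟶ S) (p : T' ⟶ S) [Etale p.left]
    (t : T.left) (t' : T'.left) (h : q.left t = p.left t') :
    ∃ (P : Sch k) (a : P ⟶ T) (b : P ⟶ T') (x : P.left), a ≫ q = b ≫ p ∧ Etale a.left ∧
      a.left x = t ∧ b.left x = t' := by
  obtain ⟨x, hx, hx'⟩ := Scheme.Pullback.exists_preimage_pullback t t' h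
  have hw : pullback.fst q.left p.left ≫ q.left = pullback.snd q.left p.left ≫ p.left :=
    pullback.condition
  refine ⟨Over.mk (pullback.fst q.left p.left ≫ T.hom), Over.homMk (pullback.fst q.left p.left),
    Over.homMk (pullback.snd q.left p.left) ?_, x, Over.OverMorphism.ext hw, ?_, hx, hx'⟩
  · rw [← Over.w p, ← Over.w q]
    exact (Category.assoc _ _ _).symm.trans
      ((congrArg (· ≫ S.hom) hw.symm).trans (Category.assoc _ _ _))
  · exact inferInstanceAs (Etale (pullback.fst q.left p.left))

/-! ### Affine schemes over the base field -/

section Sp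

variable (k) in
/-- The spectrum of a `k`-algebra, as a scheme over `k`. -/
noncomputable def Sp (R : Type u) [CommRing R] [Algebra k R] : Sch k :=
  Over.mk (Spec.map (CommRingCat.ofHom (algebraMap k R)))

variable {R R' R'' : Type u} [CommRing R] [CommRing R'] [CommRing R''] [Algebra k R] [Algebra k R']
  [Algebra k R'']

/-- The morphism of spectra given by a homomorphism of `k`-algebras. -/
noncomputable def Sp.map (φ : R →ₐ[k] R') : Sp k R' ⟶ Sp k R :=
  Over.homMk (Spec.map (CommRingCat.ofHom φ.toRingHom)) (by
    change Spec.map _ ≫ Spec.map _ = Spec.map _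
    rw [← Spec.map_comp, ← CommRingCat.ofHom_comp]
    congr 2
    exact φ.comp_algebraMap)

/-- An element of `R` as a function on `Sp R`. -/
noncomputable def gl : R →+* Γ((Sp k R).left, ⊤) :=
  (Scheme.ΓSpecIso (CommRingCat.of R)).inv.hom

theorem Sp.map_comp (φ : R →ₐ[k] R') (ψ : R' →ₐ[k] R'') :
    Sp.map (ψ.comp φ) = Sp.map ψ ≫ Sp.map φ := by
  apply Over.OverMorphism.ext
  exact Spec.map_comp (CommRingCat.ofHom φ.toRingHom) (CommRingCat.ofHom ψ.toRingHom)

theorem Sp.map_id : Sp.map (AlgHom.id k R) = 𝟙 (Sp k R) := by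
  apply Over.OverMorphism.ext
  exact Spec.map_id _

@[simp]
theorem Sp.map_appTop_gl (φ : R →ₐ[k] R') (r : R) :
    (Sp.map φ).left.appTop (gl r) = gl (φ r) :=
  (ConcreteCategory.congr_hom (Scheme.ΓSpecIso_inv_naturality (CommRingCat.ofHom φ.toRingHom)) r).symm

theorem gl_surjective : Function.Surjective (gl : R → Γ((Sp k R).left, ⊤)) :=
  (Scheme.ΓSpecIso (CommRingCat.of R)).symm.commRingCatIsoToRingEquiv.surjective

theorem Sp.hom_ext {T : Sch k} {f g : T ⟶ Sp k R}
    (h : ∀ r : R, f.left.appTop (gl r) = g.left.appTop (gl r)) : f = g := by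
  apply Over.OverMorphism.ext
  have : IsAffine (Sp k R).left := inferInstanceAs (IsAffine (Spec _))
  apply ext_of_isAffine
  ext x
  obtain ⟨r, rfl⟩ := gl_surjective x
  exact h r

theorem Sp.exists_map_eq (q : Sp k R' ⟶ Sp k R) : ∃ φ : R →ₐ[k] R', q = Sp.map φ := by
  obtain ⟨φ, hφ⟩ := Spec.map_surjective q.left
  have hw := Over.w q
  rw [← hφ] at hw
  change Spec.map _ ≫ Spec.map _ = Spec.map _ at hw
  rw [← Spec.map_comp] at hw
  have hw' := Spec.map_injective hw
  refine ⟨{ φ.hom with commutes' := fun c => ConcreteCategory.congr_hom hw' c }, ?_⟩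
  apply Over.OverMorphism.ext
  exact hφ.symm

theorem toSpecΓ_comp_SpecMap {X : Scheme.{u}} {A : CommRingCat.{u}} (q : X ⟶ Spec A) :
    X.toSpecΓ ≫ Spec.map ((Scheme.ΓSpecIso A).inv ≫ q.appTop) = q := by
  rw [Spec.map_comp, ← Scheme.toSpecΓ_naturality_assoc, ← SpecMap_ΓSpecIso_hom, ← Spec.map_comp,
    Iso.inv_hom_id, Spec.map_id, Category.comp_id]

theorem toSpecΓ_comp_SpecMap_appTop {X : Scheme.{u}} {A : CommRingCat.{u}} (φ : A ⟶ Γ(X, ⊤))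
    (x : A) : (X.toSpecΓ ≫ Spec.map φ).appTop ((Scheme.ΓSpecIso A).inv x) = φ x := by
  rw [Scheme.Hom.comp_appTop, CommRingCat.comp_apply, ← CommRingCat.comp_apply
    (Scheme.ΓSpecIso A).inv, ← Scheme.ΓSpecIso_inv_naturality, CommRingCat.comp_apply,
    Scheme.toSpecΓ_appTop, ← CommRingCat.comp_apply (Scheme.ΓSpecIso _).inv, Iso.inv_hom_id]
  rfl

/-- A morphism to `Sp R` and a function give a morphism to `Sp R[X]`. -/
theorem Sp.exists_hom_polynomial {T : Sch k} (s : T ⟶ Sp k R) (v : Γ(T.left, ⊤)) :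
    ∃ q : T ⟶ Sp k (Polynomial R), q ≫ Sp.map Polynomial.CAlgHom = s ∧
      q.left.appTop (gl Polynomial.X) = v := by
  let φ : CommRingCat.of (Polynomial R) ⟶ Γ(T.left, ⊤) := CommRingCat.ofHom
    (Polynomial.eval₂RingHom (s.left.appTop.hom.comp gl) v)
  have hφC : CommRingCat.ofHom Polynomial.C ≫ φ =
      (Scheme.ΓSpecIso (CommRingCat.of R)).inv ≫ Scheme.Hom.appTop (Y := Spec _) s.left := by
    ext r; exact Polynomial.eval₂_C _ _
  have h1 : (T.left.toSpecΓ ≫ Spec.map φ) ≫ Spec.map (CommRingCat.ofHom Polynomial.C) = s.left := by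
    rw [Category.assoc, ← Spec.map_comp, hφC]
    exact toSpecΓ_comp_SpecMap _
  have h2 : Spec.map (CommRingCat.ofHom (algebraMap k (Polynomial R))) =
      Spec.map (CommRingCat.ofHom Polynomial.C) ≫ Spec.map (CommRingCat.ofHom (algebraMap k R)) := by
    rw [← Spec.map_comp]
    rfl
  let q : T ⟶ Sp k (Polynomial R) := Over.homMk (T.left.toSpecΓ ≫ Spec.map φ) (by
    refine Eq.trans ?_ (Over.w s)
    refine Eq.trans ?_ (congrArg (· ≫ Spec.map (CommRingCat.ofHom (algebraMap k R))) h1)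
    exact (congrArg ((T.left.toSpecΓ ≫ Spec.map φ) ≫ ·) h2).trans (Category.assoc _ _ _).symm)
  refine ⟨q, Over.OverMorphism.ext h1, ?_⟩
  refine (toSpecΓ_comp_SpecMap_appTop φ Polynomial.X).trans ?_
  exact Polynomial.eval₂_X _ _

end Sp

/-! ### Values of families of maps from the line -/

section Eval

variable {Z : PreSpace k} {S : Sch k}

/-- The value of `f : S × 𝔸¹ → Z` at the point `(s, v)`. -/
noncomputable def evalAt (f : Z.obj (op (S ⊗ affineLine k))) {T : Sch k} (s : T ⟶ S)
    (v : Γ(T.left, ⊤)) : Z.obj (op T) :=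
  Z.map (lift s (pointOfCoordinate v)).op f

theorem comp_pointOfCoordinate {T T' : Sch k} (h : T' ⟶ T) (v : Γ(T.left, ⊤)) :
    h ≫ pointOfCoordinate v = pointOfCoordinate (k := k) (h.left.appTop v) := by
  apply coordinate_injective
  rw [coordinate_comp, coordinate_pointOfCoordinate, coordinate_pointOfCoordinate]

theorem map_evalAt (f : Z.obj (op (S ⊗ affineLine k))) {T T' : Sch k} (h : T' ⟶ T) (s : T ⟶ S)
    (v : Γ(T.left, ⊤)) : Z.map h.op (evalAt f s v) = evalAt f (h ≫ s) (h.left.appTop v) := by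
  simp only [evalAt, ← Functor.map_comp_apply, ← op_comp, comp_lift, comp_pointOfCoordinate]

theorem evalAt_whiskerRight (f : Z.obj (op (S ⊗ affineLine k))) {S' T : Sch k} (g : S' ⟶ S)
    (s : T ⟶ S') (v : Γ(T.left, ⊤)) :
    evalAt (Z.map (g ▷ affineLine k).op f) s v = evalAt f (s ≫ g) v := by
  simp only [evalAt, ← Functor.map_comp_apply, ← op_comp, lift_whiskerRight]

theorem evalAt_fst_coordinate_snd (f : Z.obj (op (S ⊗ affineLine k))) :
    evalAt f (fst S (affineLine k)) (coordinate (snd S (affineLine k))) = f := by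
  have h : pointOfCoordinate (coordinate (snd S (affineLine k))) = snd S (affineLine k) :=
    coordinate_injective (coordinate_pointOfCoordinate _)
  rw [evalAt, h, lift_fst_snd, op_id, Functor.map_id_apply]

/-- Equivariance of `f`, for `𝔾ₘ` acting on the line by `cⁿ`: `f (cⁿ v) = c · f (v)`. -/
theorem evalAt_mul {a : GmAction Z} {n : ℤ} {f : Z.obj (op (S ⊗ affineLine k))}
    (hf : IsEquivariant (lineAction k n) a f) {T : Sch k} (s : T ⟶ S) (c : (Γ(T.left, ⊤))ˣ)
    (v : Γ(T.left, ⊤)) :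
    evalAt f s (((c ^ n : (Γ(T.left, ⊤))ˣ) : Γ(T.left, ⊤)) * v) = a.act T c (evalAt f s v) := by
  have h := hf T s (pointOfCoordinate v) c
  refine Eq.trans ?_ h
  have h' : (lineAction k n).act T c (pointOfCoordinate v) =
      pointOfCoordinate (((c ^ n : (Γ(T.left, ⊤))ˣ) : Γ(T.left, ⊤)) * v) := by
    change pointOfCoordinate (_ * coordinate (pointOfCoordinate v)) = _
    rw [coordinate_pointOfCoordinate]
  rw [h']
  rfl

/-- The value at `0` of an equivariant family is a fixed point. -/
theorem act_evalAt_zero {a : GmAction Z} {n : ℤ} {f : Z.obj (op (S ⊗ affineLine k))}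
    (hf : IsEquivariant (lineAction k n) a f) {T : Sch k} (s : T ⟶ S) (c : (Γ(T.left, ⊤))ˣ) :
    a.act T c (evalAt f s 0) = evalAt f s 0 := by
  rw [← evalAt_mul hf, mul_zero]

/-- The family `f` of maps `𝔸¹ → Z` parametrized by `S` is constant along `𝔸¹` after base change
along `g : S' → S`. -/
def ConstAlong (f : Z.obj (op (S ⊗ affineLine k))) {S' : Sch k} (g : S' ⟶ S) : Prop :=
  ∀ (T : Sch k) (s : T ⟶ S') (v : Γ(T.left, ⊤)), evalAt f (s ≫ g) v = evalAt f (s ≫ g) 0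

theorem ConstAlong.comp {f : Z.obj (op (S ⊗ affineLine k))} {S' S'' : Sch k} {g : S' ⟶ S}
    (h : ConstAlong f g) (g' : S'' ⟶ S') : ConstAlong f (g' ≫ g) := by
  intro T s v
  have := h T (s ≫ g') v
  rwa [Category.assoc] at this

theorem ConstAlong.eq {f : Z.obj (op (S ⊗ affineLine k))} {S' : Sch k} {g : S' ⟶ S}
    (h : ConstAlong f g) {T : Sch k} (s : T ⟶ S') (v w : Γ(T.left, ⊤)) :
    evalAt f (s ≫ g) v = evalAt f (s ≫ g) w :=
  (h T s v).trans (h T s w).symm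

theorem constAlong_of_etale_local
    (hZ : Presheaf.IsSheaf (Scheme.etaleTopology.over (Spec (CommRingCat.of k))) Z)
    (f : Z.obj (op (S ⊗ affineLine k))) {S' : Sch k} (g : S' ⟶ S)
    (h : ∀ s : S'.left, ∃ (T : Sch k) (p : T ⟶ S'), Etale p.left ∧ s ∈ Set.range p.left ∧
      ConstAlong f (p ≫ g)) : ConstAlong f g := by
  intro T q v
  refine eq_of_etale_local hZ _ _ fun t => ?_
  obtain ⟨T₁, p, hp, ⟨t₁, ht₁⟩, hc⟩ := h (q.left t)
  obtain ⟨P, b, c, x, hw, hb, hx, -⟩ := exists_etale_pullback q p t t₁ ht₁.symm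
  refine ⟨P, b, hb, ⟨x, hx⟩, ?_⟩
  rw [map_evalAt, map_evalAt, map_zero, ← Category.assoc, hw, Category.assoc]
  exact hc P c _

/-- Constancy over `R` can be tested on the universal point `X` of the line over `R`. -/
theorem constAlong_Sp_iff {R : Type u} [CommRing R] [Algebra k R]
    (f : Z.obj (op (S ⊗ affineLine k))) (g : Sp k R ⟶ S) :
    ConstAlong f g ↔
      evalAt f (Sp.map (Polynomial.CAlgHom : R →ₐ[k] Polynomial R) ≫ g) (gl Polynomial.X) =
      evalAt f (Sp.map (Polynomial.CAlgHom : R →ₐ[k] Polynomial R) ≫ g) 0 := by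
  refine ⟨fun h => h _ _ _, fun h T s v => ?_⟩
  obtain ⟨q, hq, hv⟩ := Sp.exists_hom_polynomial s v
  have := congrArg (Z.map q.op) h
  rwa [map_evalAt, map_evalAt, ← Category.assoc, hq, hv, map_zero] at this

end Eval

/-! ### Lifting along étale morphisms -/

/-- Two sections of an unramified morphism which agree after a surjective morphism are equal. -/
theorem unramified_hom_ext {T₀ T W X : Scheme.{u}} (i : T₀ ⟶ T) [Surjective i] (p : W ⟶ X)
    [FormallyUnramified p] [LocallyOfFiniteType p] (l₁ l₂ : T ⟶ W) (hp : l₁ ≫ p = l₂ ≫ p)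
    (hi : i ≫ l₁ = i ≫ l₂) : l₁ = l₂ := by
  let m : T ⟶ pullback p p := pullback.lift l₁ l₂ hp
  have hm₁ : m ≫ pullback.fst p p = l₁ := pullback.lift_fst _ _ _
  have hm₂ : m ≫ pullback.snd p p = l₂ := pullback.lift_snd _ _ _
  have hm : i ≫ m = (i ≫ l₁) ≫ pullback.diagonal p := by
    apply pullback.hom_ext
    · rw [Category.assoc, hm₁, Category.assoc, pullback.diagonal_fst, Category.comp_id]
    · rw [Category.assoc, hm₂, Category.assoc, pullback.diagonal_snd, Category.comp_id, hi]
  have hrange : Set.range m ⊆ Set.range (pullback.diagonal p) := by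
    rintro _ ⟨t, rfl⟩
    obtain ⟨t₀, rfl⟩ := i.surjective t
    refine ⟨(i ≫ l₁) t₀, ?_⟩
    rw [← Scheme.Hom.comp_apply, ← hm, Scheme.Hom.comp_apply]
  have hlift := IsOpenImmersion.lift_fac (pullback.diagonal p) m hrange
  rw [← hm₁, ← hm₂, ← hlift, Category.assoc, Category.assoc, pullback.diagonal_fst,
    pullback.diagonal_snd]

/-- A section of an étale morphism `W → T` over a closed subscheme `T₀` with the same underlying
space as `T` extends to `T`: its image is an open subscheme of `W` which is isomorphic to `T`. -/
theorem exists_etale_section {T₀ T W : Scheme.{u}} (i : T₀ ⟶ T) [Surjective i] [IsClosedImmersion i]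
    (p : W ⟶ T) [Etale p] (s₀ : T₀ ⟶ W) (hs₀ : s₀ ≫ p = i) :
    ∃ s : T ⟶ W, s ≫ p = 𝟙 T ∧ i ≫ s = s₀ := by
  -- the section of the base change `W₀ → T₀` is an open immersion
  let σ : T₀ ⟶ pullback p i := pullback.lift s₀ (𝟙 _) (by simpa using hs₀)
  have hσ : σ ≫ pullback.snd p i = 𝟙 _ := pullback.lift_snd _ _ _
  have hσ' : σ ≫ pullback.fst p i = s₀ := pullback.lift_fst _ _ _
  have : Etale (σ ≫ pullback.snd p i) := by rw [hσ]; infer_instance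
  have : Etale σ := Etale.of_comp σ (pullback.snd p i)
  have : Mono (σ ≫ pullback.snd p i) := by rw [hσ]; infer_instance
  have : Mono σ := mono_of_mono σ (pullback.snd p i)
  have : IsOpenImmersion σ := IsOpenImmersion.of_flat_of_mono σ
  have hinj : Function.Injective (pullback.fst p i) := Scheme.Hom.injective _
  have hsurj : Function.Surjective (pullback.fst p i) := Scheme.Hom.surjective _
  have hrange : Set.range s₀ = (pullback.fst p i) '' Set.range σ := by
    rw [← Set.range_comp, ← hσ']
    rfl
  have hopen : IsOpen (Set.range s₀) := by
    rw [hrange, ← isClosed_compl_iff, ← Set.image_compl_eq ⟨hinj, hsurj⟩]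
    exact (pullback.fst p i).isClosedEmbedding.isClosedMap _
      σ.isOpenEmbedding.isOpen_range.isClosed_compl
  let Ω : W.Opens := ⟨Set.range s₀, hopen⟩
  -- morphisms into `Ω` from schemes over `T₀` are determined by the projection to `T₀`
  have key : ∀ {Q : Scheme.{u}} (c : Q ⟶ Ω) (e : Q ⟶ T₀), c ≫ Ω.ι ≫ p = e ≫ i →
      c ≫ Ω.ι = e ≫ s₀ := by
    intro Q c e hce
    let c' : Q ⟶ pullback p i := pullback.lift (c ≫ Ω.ι) e (by simpa using hce)
    have hc1 : c' ≫ pullback.fst p i = c ≫ Ω.ι := pullback.lift_fst _ _ _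
    have hc2 : c' ≫ pullback.snd p i = e := pullback.lift_snd _ _ _
    have hr : Set.range c' ⊆ Set.range σ := by
      rintro _ ⟨x, rfl⟩
      have : (pullback.fst p i) (c' x) ∈ (pullback.fst p i) '' Set.range σ := by
        rw [← hrange, ← Scheme.Hom.comp_apply, hc1, Scheme.Hom.comp_apply]
        exact (c x).2
      obtain ⟨y, hy, hyx⟩ := this
      rwa [← hinj hyx]
    have hl := IsOpenImmersion.lift_fac σ c' hr
    have hle : IsOpenImmersion.lift σ c' hr = e := by
      have := congrArg (· ≫ pullback.snd p i) hl
      rw [hc2, Category.assoc, hσ, Category.comp_id] at this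
      exact this
    rw [← hc1, ← hl, hle, Category.assoc, hσ']
  have hmono : Mono (Ω.ι ≫ p) := by
    constructor
    intro Q g₁ g₂ hg
    rw [← cancel_mono Ω.ι]
    refine unramified_hom_ext (pullback.fst (g₁ ≫ Ω.ι ≫ p) i) p _ _
      (by simpa using hg) ?_
    have h1 := key (pullback.fst (g₁ ≫ Ω.ι ≫ p) i ≫ g₁) (pullback.snd _ _)
      (by rw [Category.assoc, pullback.condition])
    have h2 := key (pullback.fst (g₁ ≫ Ω.ι ≫ p) i ≫ g₂) (pullback.snd _ _)
      (by rw [Category.assoc, ← hg, pullback.condition])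
    rw [Category.assoc] at h1 h2
    rw [h1, h2]
  have : IsOpenImmersion (Ω.ι ≫ p) := IsOpenImmersion.of_flat_of_mono _
  have : Surjective (Ω.ι ≫ p) := by
    refine ⟨fun t => ?_⟩
    obtain ⟨t₀, rfl⟩ := i.surjective t
    refine ⟨⟨s₀ t₀, ⟨t₀, rfl⟩⟩, ?_⟩
    rw [← hs₀]
    rfl
  have : IsIso (Ω.ι ≫ p) := by
    have : Epi (Ω.ι ≫ p).base := (TopCat.epi_iff_surjective _).mpr (Scheme.Hom.surjective (Ω.ι ≫ p))
    exact IsOpenImmersion.isIso _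
  refine ⟨inv (Ω.ι ≫ p) ≫ Ω.ι, by simp, ?_⟩
  rw [← Category.assoc, key (i ≫ inv (Ω.ι ≫ p)) (𝟙 _) (by simp), Category.id_comp]

/-! ### Étale charts -/

theorem isStableUnderBaseChange_over (P : MorphismProperty Scheme.{u}) [P.IsStableUnderBaseChange]
    (X : Scheme.{u}) : (P.over (X := X)).IsStableUnderBaseChange where
  of_isPullback h hf := P.of_isPullback (h.map (Over.forget X)) hf

theorem isStableUnderComposition_etale_over (X : Scheme.{u}) :
    (MorphismProperty.over (X := X) @Etale).IsStableUnderComposition where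
  comp_mem f g hf hg := by
    have : Etale f.left := hf
    have : Etale g.left := hg
    exact inferInstanceAs (Etale (f.left ≫ g.left))

/-- A morphism `U → Z`, given as a section over `U`, is schematic and étale. -/
def IsEtaleSection {Z : PreSpace k} {U : Sch k} (u : Z.obj (op U)) : Prop :=
  Schematic @Etale (yonedaEquiv.symm u)

section

variable {Z : PreSpace k} {U : Sch k} {u : Z.obj (op U)}

theorem yoneda_map_comp_yonedaEquiv_symm {T : Sch k} (q : T ⟶ U) :
    yoneda.map q ≫ yonedaEquiv.symm u = yonedaEquiv.symm (Z.map q.op u) := by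
  apply yonedaEquiv.injective
  rw [← yonedaEquiv_naturality]
  simp

/-- The fibre product of an étale chart `U → Z` with `T → Z` is a scheme `W` étale over `T`. -/
theorem IsEtaleSection.exists_pullback (hu : IsEtaleSection u) {T : Sch k} (z : Z.obj (op T)) :
    ∃ (W : Sch k) (p : W ⟶ T) (q : W ⟶ U), Etale p.left ∧ Z.map q.op u = Z.map p.op z ∧
      (Schematic @Surjective (yonedaEquiv.symm u) → Surjective p.left) ∧
      ∀ (T' : Sch k) (h : T' ⟶ T) (g : T' ⟶ U), Z.map g.op u = Z.map h.op z →
        ∃ l : T' ⟶ W, l ≫ p = h ∧ l ≫ q = g ∧ ∀ l' : T' ⟶ W, l' ≫ p = h → l' ≫ q = g → l' = l := by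
  obtain ⟨W, p, q', hpb⟩ := hu.rep (yonedaEquiv.symm z)
  obtain ⟨q, rfl⟩ := yoneda.map_surjective q'
  refine ⟨W, p, q, hu.property _ _ _ hpb, ?_, fun hs => hs.property _ _ _ hpb, ?_⟩
  · have := hpb.w
    rw [yoneda_map_comp_yonedaEquiv_symm, yoneda_map_comp_yonedaEquiv_symm] at this
    exact yonedaEquiv.symm.injective this
  · intro T' h g hgh
    have hw : yoneda.map g ≫ yonedaEquiv.symm u = yoneda.map h ≫ yonedaEquiv.symm z := by
      rw [yoneda_map_comp_yonedaEquiv_symm, yoneda_map_comp_yonedaEquiv_symm, hgh]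
    obtain ⟨l, hl⟩ := yoneda.map_surjective (hpb.lift _ _ hw)
    have hp : l ≫ p = h := yoneda.map_injective (by rw [Functor.map_comp, hl, hpb.lift_snd])
    have hq : l ≫ q = g := yoneda.map_injective (by rw [Functor.map_comp, hl, hpb.lift_fst])
    refine ⟨l, hp, hq, fun l' hp' hq' => yoneda.map_injective (hpb.hom_ext ?_ ?_)⟩
    · rw [← Functor.map_comp, ← Functor.map_comp, hq, hq']
    · rw [← Functor.map_comp, ← Functor.map_comp, hp, hp']

theorem IsEtaleSection.map (hu : IsEtaleSection u) {U' : Sch k} (e : U' ⟶ U) [Etale e.left] :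
    IsEtaleSection (Z.map e.op u) := by
  rw [IsEtaleSection, ← yoneda_map_comp_yonedaEquiv_symm]
  have := isStableUnderBaseChange_over @Etale (Spec (CommRingCat.of k))
  have := isStableUnderComposition_etale_over (Spec (CommRingCat.of k))
  have : (Schematic (k := k) @Etale).IsStableUnderComposition :=
    MorphismProperty.relative_isStableUnderComposition _
  refine MorphismProperty.comp_mem _ _ _ ?_ hu
  exact MorphismProperty.relative_map (P := MorphismProperty.over _) (F := yoneda) (by assumption)

/-- Étale charts are unramified. -/
theorem IsEtaleSection.hom_ext (hu : IsEtaleSection u) {T₀ T : Sch k} (i : T₀ ⟶ T)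
    [Surjective i.left] (g₁ g₂ : T ⟶ U) (hz : Z.map g₁.op u = Z.map g₂.op u)
    (hi : i ≫ g₁ = i ≫ g₂) : g₁ = g₂ := by
  obtain ⟨W, p, q, hp, -, -, hl⟩ := hu.exists_pullback (Z.map g₁.op u)
  obtain ⟨l₁, hp₁, hq₁, -⟩ := hl T (𝟙 T) g₁ (by simp)
  obtain ⟨l₂, hp₂, hq₂, -⟩ := hl T (𝟙 T) g₂ (by simp [hz])
  obtain ⟨l, -, -, hl'⟩ := hl T₀ i (i ≫ g₁) (by simp)
  have h₁ : i ≫ l₁ = l := hl' _ (by simp [hp₁]) (by simp [hq₁])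
  have h₂ : i ≫ l₂ = l := hl' _ (by simp [hp₂]) (by simp [hq₂, hi])
  have hl : l₁ = l₂ := by
    apply Over.OverMorphism.ext
    apply unramified_hom_ext i.left p.left
    · rw [← Over.comp_left, ← Over.comp_left, hp₁, hp₂]
    · rw [← Over.comp_left, ← Over.comp_left, h₁, h₂]
  rw [← hq₁, ← hq₂, hl]

/-- Étale charts satisfy the infinitesimal lifting property. -/
theorem IsEtaleSection.exists_lift (hu : IsEtaleSection u) {T₀ T : Sch k} (i : T₀ ⟶ T)
    [Surjective i.left] [IsClosedImmersion i.left] (z : Z.obj (op T)) (g₀ : T₀ ⟶ U)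
    (hz : Z.map g₀.op u = Z.map i.op z) : ∃ g : T ⟶ U, Z.map g.op u = z ∧ i ≫ g = g₀ := by
  obtain ⟨W, p, q, hp, hqp, -, hl⟩ := hu.exists_pullback z
  obtain ⟨l, hlp, hlq, -⟩ := hl T₀ i g₀ hz
  obtain ⟨s, hs, hs'⟩ := exists_etale_section i.left p.left l.left (by rw [← hlp]; rfl)
  let s' : T ⟶ W := Over.homMk s (by rw [← Over.w p, ← Category.assoc, hs, Category.id_comp])
  have h1 : s' ≫ p = 𝟙 T := Over.OverMorphism.ext hs
  have h2 : i ≫ s' = l := Over.OverMorphism.ext hs'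
  refine ⟨s' ≫ q, ?_, by rw [← Category.assoc, h2, hlq]⟩
  rw [op_comp, Functor.map_comp_apply, hqp, ← Functor.map_comp_apply, ← op_comp, h1, op_id,
    Functor.map_id_apply]

end

/-! ### Étale local units -/

section

open Polynomial

/-- A polynomial of degree less than `m` over a field in which `m` is invertible does not vanish
at all the `m`-th roots of unity of an algebraically closed extension. -/
theorem exists_pow_eq_one_of_natDegree_lt {K : Type*} [Field K] [IsAlgClosed K] {m : ℕ}
    (hm : (m : K) ≠ 0) (p : K[X]) (hp : p ≠ 0) (hdeg : p.natDegree < m) :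
    ∃ ζ : K, ζ ^ m = 1 ∧ p.eval ζ ≠ 0 := by
  by_contra! h
  have hsep : (X ^ m - C (1 : K)).Separable := separable_X_pow_sub_C 1 hm one_ne_zero
  have hm0 : 0 < m := by omega
  have hdvd : X ^ m - C (1 : K) ∣ p := by
    have hs := IsAlgClosed.splits (X ^ m - C (1 : K))
    rw [hs.dvd_iff_roots_le_roots (X_pow_sub_C_ne_zero hm0 _) hp,
      Multiset.le_iff_subset (nodup_roots hsep)]
    intro ζ hζ
    rw [mem_roots (X_pow_sub_C_ne_zero hm0 _)] at hζ
    rw [mem_roots hp]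
    exact h ζ (by simpa [sub_eq_zero] using hζ)
  have := natDegree_le_of_dvd hdvd hp
  rw [natDegree_X_pow_sub_C] at this
  omega

/-- A polynomial with constant coefficient `1` takes a unit as value at some unit, étale locally
on the base: one adjoins a root of unity of large order. -/
theorem exists_etale_isUnit_eval₂ {Λ : Type u} [CommRing Λ] [Algebra k Λ] (P : Λ[X])
    (hP : P.coeff 0 = 1) (t : PrimeSpectrum Λ) :
    ∃ (Λ' : Type u) (_ : CommRing Λ') (_ : Algebra k Λ') (φ : Λ →ₐ[k] Λ')
      (t' : PrimeSpectrum Λ') (y : Λ'ˣ), φ.toRingHom.Etale ∧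
      PrimeSpectrum.comap φ.toRingHom t' = t ∧ IsUnit (P.eval₂ φ.toRingHom (y : Λ')) := by
  obtain ⟨m, hdeg, hm⟩ : ∃ m : ℕ, P.natDegree < m ∧ (m : k) ≠ 0 := by
    by_cases h : ((P.natDegree + 1 : ℕ) : k) = 0
    · refine ⟨P.natDegree + 2, by omega, fun h' => one_ne_zero (α := k) ?_⟩
      rw [Nat.cast_add, Nat.cast_one] at h
      rw [show P.natDegree + 2 = (P.natDegree + 1) + 1 from rfl, Nat.cast_add, Nat.cast_add,
        Nat.cast_one, h, zero_add] at h'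
      exact h'
    · exact ⟨_, by omega, h⟩
  have hm0 : m ≠ 0 := by omega
  have hmΛ : algebraMap k Λ (m : k)⁻¹ * (m : Λ) = 1 := by
    rw [← map_natCast (algebraMap k Λ), ← map_mul, inv_mul_cancel₀ hm, map_one]
  let pair : StandardEtalePair Λ :=
    { f := X ^ m - C 1
      monic_f := monic_X_pow_sub_C 1 hm0
      g := P
      cond := by
        refine ⟨C (algebraMap k Λ (m : k)⁻¹) * X * P, -P, 1, ?_⟩
        have h1 : (C (algebraMap k Λ (m : k)⁻¹) * C (m : Λ) : Λ[X]) = 1 := by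
          rw [← C_mul, hmΛ, C_1]
        have h2 : (X : Λ[X]) ^ (m - 1) * X = X ^ m := by
          rw [← pow_succ, Nat.sub_add_cancel (Nat.pos_of_ne_zero hm0)]
        simp only [derivative_sub, derivative_X_pow, derivative_one, sub_zero, pow_one, C_1]
        linear_combination (X ^ (m - 1) * X * P) * h1 + P * h2 }
  let φ : Λ →+* pair.Ring := algebraMap Λ pair.Ring
  have hX := pair.hasMap_X
  have hXm : pair.X ^ m = 1 := by
    have := hX.1
    simpa [pair, sub_eq_zero] using this
  let K := AlgebraicClosure t.asIdeal.ResidueField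
  let ι : Λ →+* K := (algebraMap t.asIdeal.ResidueField K).comp (algebraMap Λ _)
  have hmK : (m : K) ≠ 0 := by
    intro h
    have := congrArg ι hmΛ
    rw [map_mul, map_natCast, h, mul_zero, map_one] at this
    exact zero_ne_one this
  obtain ⟨ζ, hζ, hPζ⟩ := exists_pow_eq_one_of_natDegree_lt hmK (P.map ι)
    (fun h => by simpa [hP] using congrArg (coeff · 0) h) (natDegree_map_le.trans_lt hdeg)
  let _ : Algebra Λ K := ι.toAlgebra
  have hmap : pair.HasMap ζ := by
    refine ⟨by simp [pair, hζ], ?_⟩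
    rw [aeval_def, eval₂_eq_eval_map]
    exact IsUnit.mk0 _ hPζ
  let χ : pair.Ring →ₐ[Λ] K := pair.lift ζ hmap
  let _ : Algebra k pair.Ring := (φ.comp (algebraMap k Λ)).toAlgebra
  refine ⟨pair.Ring, inferInstance, inferInstance, { φ with commutes' := fun _ => rfl },
    PrimeSpectrum.comap χ.toRingHom ⊥, ⟨pair.X, pair.X ^ (m - 1), ?_, ?_⟩,
    ?_, ?_, ?_⟩
  · rw [← pow_succ', Nat.sub_add_cancel (Nat.pos_of_ne_zero hm0), hXm]
  · rw [← pow_succ, Nat.sub_add_cancel (Nat.pos_of_ne_zero hm0), hXm]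
  · exact RingHom.etale_algebraMap.mpr (inferInstanceAs (Algebra.Etale Λ pair.Ring))
  · rw [← PrimeSpectrum.comap_comp_apply]
    have : χ.toRingHom.comp φ = ι := RingHom.ext fun x => χ.commutes x
    refine (congrArg (PrimeSpectrum.comap · ⊥) this).trans ?_
    apply PrimeSpectrum.ext
    ext x
    change ι x = 0 ↔ _
    change algebraMap _ K (algebraMap Λ t.asIdeal.ResidueField x) = 0 ↔ _
    rw [map_eq_zero, Ideal.algebraMap_residueField_eq_zero]
  · exact hX.2

end

/-! ### Extending constancy from a neighbourhood of the zero section -/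

theorem Sp.map_etale {R R' : Type u} [CommRing R] [CommRing R'] [Algebra k R] [Algebra k R']
    {φ : R →ₐ[k] R'} (h : φ.toRingHom.Etale) : Etale (Sp.map φ).left :=
  HasRingHomProperty.Spec_iff.mpr h

/-- The homomorphism of `k`-algebras `R[X] → R'` given by `φ : R → R'` and the image of `X`. -/
noncomputable def polyHom {R R' : Type u} [CommRing R] [CommRing R'] [Algebra k R] [Algebra k R']
    (φ : R →ₐ[k] R') (v : R') : Polynomial R →ₐ[k] R' :=
  { Polynomial.eval₂RingHom φ.toRingHom v with
    commutes' := fun c => (Polynomial.eval₂_C _ _).trans (φ.commutes c) }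

section

variable {R R' : Type u} [CommRing R] [CommRing R'] [Algebra k R] [Algebra k R']

@[simp]
theorem polyHom_C (φ : R →ₐ[k] R') (v : R') (r : R) : polyHom φ v (Polynomial.C r) = φ r :=
  Polynomial.eval₂_C _ _

@[simp]
theorem polyHom_X (φ : R →ₐ[k] R') (v : R') : polyHom φ v Polynomial.X = v :=
  Polynomial.eval₂_X _ _

theorem polyHom_apply (φ : R →ₐ[k] R') (v : R') (p : Polynomial R) :
    polyHom φ v p = p.eval₂ φ.toRingHom v := rfl

@[simp]
theorem polyHom_comp_CAlgHom (φ : R →ₐ[k] R') (v : R') :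
    (polyHom φ v).comp Polynomial.CAlgHom = φ :=
  AlgHom.ext fun r => polyHom_C φ v r

end

/-- An equivariant family of maps `𝔸¹ → Z` which is constant étale locally around the zero section
is constant: any coordinate can be scaled, étale locally, by a unit which moves it to the
given neighbourhood of the zero section. -/
theorem constAlong_of_nhd_zero {Z : PreSpace k}
    (hZ : Presheaf.IsSheaf (Scheme.etaleTopology.over (Spec (CommRingCat.of k))) Z)
    {S : Sch k} {a : GmAction Z} {n : ℤ} (hn : n * n = 1) {f : Z.obj (op (S ⊗ affineLine k))}
    (hf : IsEquivariant (lineAction k n) a f)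
    {R : Type u} [CommRing R] [Algebra k R] (q : Sp k R ⟶ S)
    (h : ∀ t : (Sp k R).left, ∃ (T : Sch k) (e : T ⟶ Sp k (Polynomial R)), Etale e.left ∧
      (Sp.map (polyHom (AlgHom.id k R) 0)).left t ∈ Set.range e.left ∧
      evalAt f (e ≫ Sp.map Polynomial.CAlgHom ≫ q) (e.left.appTop (gl Polynomial.X)) =
        evalAt f (e ≫ Sp.map Polynomial.CAlgHom ≫ q) 0) : ConstAlong f q := by
  choose T e he hrange heq using h
  -- `N` is an open neighbourhood of the zero section
  let N : Set (PrimeSpectrum (Polynomial R)) := ⋃ t, Set.range (e t).left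
  have hN : IsOpen N := isOpen_iUnion fun t => (e t).left.isOpenMap.isOpen_range
  obtain ⟨J, hJ⟩ := (PrimeSpectrum.isClosed_iff_zeroLocus_ideal _).mp hN.isClosed_compl
  have hsup : Ideal.span {Polynomial.X} ⊔ J = ⊤ := by
    by_contra hne
    obtain ⟨m, hm, hle⟩ := Ideal.exists_le_maximal _ hne
    rw [sup_le_iff, Ideal.span_singleton_le_iff_mem] at hle
    let t : PrimeSpectrum (Polynomial R) := ⟨m, hm.isPrime⟩
    have h1 : t ∈ Nᶜ := by rw [hJ]; exact hle.2
    refine h1 ?_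
    have h2 := hrange (PrimeSpectrum.comap (Polynomial.C : R →+* _) t)
    have h3 : PrimeSpectrum.comap (polyHom (AlgHom.id k R) 0).toRingHom
        (PrimeSpectrum.comap (Polynomial.C : R →+* _) t) = t := by
      apply PrimeSpectrum.ext
      ext p
      have hp : p - Polynomial.C (p.coeff 0) ∈ m :=
        m.mem_of_dvd (Polynomial.X_dvd_iff.mpr (by simp)) hle.1
      have hp' : polyHom (AlgHom.id k R) 0 p = p.coeff 0 := by
        rw [polyHom_apply, Polynomial.coeff_zero_eq_eval_zero]
        rfl
      change Polynomial.C (polyHom (AlgHom.id k R) 0 p) ∈ m ↔ p ∈ m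
      rw [hp', ← Ideal.add_mem_iff_right m hp, sub_add_cancel]
    exact Set.mem_iUnion.mpr ⟨_, (congrArg (· ∈ Set.range _) h3).mp h2⟩
  obtain ⟨b, g, hg, hbg⟩ : ∃ b g, g ∈ J ∧ Polynomial.X * b + g = 1 := by
    have := (Ideal.eq_top_iff_one _).mp hsup
    obtain ⟨x, hx, g, hg, hxg⟩ := Submodule.mem_sup.mp this
    obtain ⟨b, rfl⟩ := Ideal.mem_span_singleton.mp hx
    exact ⟨b, g, hg, hxg⟩
  have hg0 : g.coeff 0 = 1 := by
    have := congrArg (Polynomial.coeff · 0) hbg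
    simpa using this
  have hgN : ∀ x : PrimeSpectrum (Polynomial R), g ∉ x.asIdeal → x ∈ N := by
    intro x hx
    by_contra hxN
    have : x ∈ PrimeSpectrum.zeroLocus (J : Set (Polynomial R)) := by rw [← hJ]; exact hxN
    exact hx (this hg)
  rw [constAlong_Sp_iff]
  refine eq_of_etale_local hZ _ _ fun t => ?_
  -- a unit `y` such that `g (X * y)` is invertible
  let P : Polynomial (Polynomial R) :=
    (g.map Polynomial.C).comp (Polynomial.C Polynomial.X * Polynomial.X)
  have hP : P.coeff 0 = 1 := by
    rw [Polynomial.coeff_zero_eq_eval_zero, Polynomial.eval_comp]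
    simp [← Polynomial.coeff_zero_eq_eval_zero, hg0]
  obtain ⟨Λ, _, _, φ, t', y, hφ, ht', hy⟩ := exists_etale_isUnit_eval₂ (k := k) P hP t
  let v : Λ := φ Polynomial.X * y
  let φC : R →ₐ[k] Λ := φ.comp Polynomial.CAlgHom
  have hPv : P.eval₂ φ.toRingHom (y : Λ) = polyHom φC v g := by
    rw [Polynomial.eval₂_comp, Polynomial.eval₂_map, polyHom_apply]
    congr 1
    simp [v]
  rw [hPv] at hy
  obtain ⟨t₀, z, hz⟩ := Set.mem_iUnion.mp (hgN (PrimeSpectrum.comap (polyHom φC v).toRingHom t')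
    fun hmem => t'.isPrime.ne_top (Ideal.eq_top_of_isUnit_mem _ hmem hy))
  have := he t₀
  obtain ⟨W, α, β, w, hαβ, hα, hαw, -⟩ := exists_etale_pullback (Sp.map (polyHom φC v)) (e t₀) t' z
    hz.symm
  have := Sp.map_etale hφ
  refine ⟨W, α ≫ Sp.map φ, inferInstanceAs (Etale (α.left ≫ (Sp.map φ).left)), ⟨w, ?_⟩, ?_⟩
  · rw [Over.comp_left, Scheme.Hom.comp_apply, hαw]
    exact ht'
  rw [map_evalAt, map_evalAt, map_zero]
  -- rescale by the inverse of `y`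
  have hs : (α ≫ Sp.map φ) ≫ Sp.map Polynomial.CAlgHom ≫ q = α ≫ Sp.map φC ≫ q := by
    simp only [φC, Sp.map_comp, Category.assoc]
  have hs' : β ≫ e t₀ ≫ Sp.map Polynomial.CAlgHom ≫ q = α ≫ Sp.map φC ≫ q := by
    rw [← Category.assoc β, ← hαβ, Category.assoc, ← Category.assoc (Sp.map (polyHom φC v)),
      ← Sp.map_comp, polyHom_comp_CAlgHom]
  have hv : β.left.appTop ((e t₀).left.appTop (gl Polynomial.X)) = α.left.appTop (gl v) := by
    have h1 : (β ≫ e t₀).left.appTop (gl Polynomial.X) =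
        (α ≫ Sp.map (polyHom φC v)).left.appTop (gl Polynomial.X) := by rw [hαβ]
    rw [Over.comp_left, Over.comp_left, Scheme.Hom.comp_appTop, Scheme.Hom.comp_appTop,
      CommRingCat.comp_apply, CommRingCat.comp_apply, Sp.map_appTop_gl, polyHom_X] at h1
    exact h1
  have hX : (α ≫ Sp.map φ).left.appTop (gl Polynomial.X) = α.left.appTop (gl (φ Polynomial.X)) := by
    rw [Over.comp_left, Scheme.Hom.comp_appTop, CommRingCat.comp_apply, Sp.map_appTop_gl]
  have key := congrArg (Z.map β.op) (heq t₀)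
  rw [map_evalAt, map_evalAt, map_zero, hs', hv] at key
  let Y : (Γ(W.left, ⊤))ˣ := Units.map (α.left.appTop.hom.comp gl : Λ →* _) y
  let c : (Γ(W.left, ⊤))ˣ := Y ^ (-n)
  have hc : c ^ n = Y⁻¹ := by rw [← zpow_mul, neg_mul, hn, zpow_neg_one]
  have hvc : α.left.appTop (gl (φ Polynomial.X)) =
      ((c ^ n : (Γ(W.left, ⊤))ˣ) : Γ(W.left, ⊤)) * α.left.appTop (gl v) := by
    rw [hc, Units.eq_inv_mul_iff_mul_eq, mul_comm]
    exact ((α.left.appTop.hom.comp gl).map_mul (φ Polynomial.X) (y : Λ)).symm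
  rw [hs, hX, hvc, evalAt_mul hf, key, act_evalAt_zero hf]

/-! ### The locus of constancy in an étale chart -/

theorem Sp.comp_map_appTop_gl {R R' : Type u} [CommRing R] [CommRing R'] [Algebra k R]
    [Algebra k R'] {T : Sch k} (q : T ⟶ Sp k R') (φ : R →ₐ[k] R') (r : R) :
    (q ≫ Sp.map φ).left.appTop (gl r) = q.left.appTop (gl (φ r)) := by
  rw [Over.comp_left, Scheme.Hom.comp_appTop, CommRingCat.comp_apply, Sp.map_appTop_gl]

theorem Sp.map_surjective {R R' : Type u} [CommRing R] [CommRing R'] [Algebra k R] [Algebra k R']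
    (φ : R →ₐ[k] R') (hφ : Function.Surjective φ) (hker : ∀ x, φ x = 0 → IsNilpotent x) :
    Surjective (Sp.map φ).left := by
  refine ⟨fun (x : PrimeSpectrum R) => ?_⟩
  have h := range_comap_of_surjective R' φ.toRingHom hφ
  have hx : x ∈ PrimeSpectrum.zeroLocus (RingHom.ker φ.toRingHom : Set R) :=
    fun r hr => by
      obtain ⟨n, hn⟩ := hker r hr
      exact x.isPrime.mem_of_pow_mem n (hn ▸ x.asIdeal.zero_mem)
  rw [← h] at hx
  exact hx

theorem Sp.map_isClosedImmersion {R R' : Type u} [CommRing R] [CommRing R'] [Algebra k R]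
    [Algebra k R'] (φ : R →ₐ[k] R') (hφ : Function.Surjective φ) :
    IsClosedImmersion (Sp.map φ).left :=
  IsClosedImmersion.spec_of_surjective (CommRingCat.ofHom φ.toRingHom) hφ

section

open Polynomial

variable {Z : PreSpace k} {S : Sch k} {f : Z.obj (op (S ⊗ affineLine k))}
  {R : Type u} [CommRing R] [Algebra k R] {q : Sp k R ⟶ S}
  {B : Type u} [CommRing B] [Algebra k B] [Algebra R[X] B] [IsScalarTower k R[X] B]
  {σ : B →ₐ[k] R} {A : Type u} [CommRing A] [Algebra k A] {u₀ : Z.obj (op (Sp k A))} {g : A →ₐ[k] B}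

/-- If a family of maps `𝔸¹ → Z` lifts, on a neighbourhood of the zero section, to a map `g` to a
chart `u₀`, then its restriction to the zero section lifts to the restriction of `g`. -/
theorem map_section_comp (hσ : ∀ p, σ (algebraMap R[X] B p) = p.coeff 0)
    (hg : Z.map (Sp.map g).op u₀ =
      evalAt f (Sp.map (IsScalarTower.toAlgHom k R[X] B) ≫ Sp.map CAlgHom ≫ q)
        (gl (algebraMap R[X] B X))) :
    Z.map (Sp.map (σ.comp g)).op u₀ = evalAt f q 0 := by
  rw [Sp.map_comp, op_comp, Functor.map_comp_apply, hg, map_evalAt, Sp.map_appTop_gl, hσ, coeff_X_zero,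
    map_zero, ← Category.assoc, ← Category.assoc, ← Sp.map_comp, ← Sp.map_comp]
  have : (σ.comp (IsScalarTower.toAlgHom k R[X] B)).comp CAlgHom = AlgHom.id k R :=
    AlgHom.ext fun r => (hσ (C r)).trans coeff_C_zero
  rw [this, Sp.map_id, Category.id_comp]

/-- If the family `f` becomes constant after the base change `φ : R → R'`, then so do the Taylor
expansions, along the zero section, of the coordinates of `f` in a chart. -/
theorem ConstAlong.map_coeff_eq_zero [Algebra.FormallySmooth R[X] B] (hu : IsEtaleSection u₀)
    (hσ : ∀ p, σ (algebraMap R[X] B p) = p.coeff 0)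
    (hg : Z.map (Sp.map g).op u₀ =
      evalAt f (Sp.map (IsScalarTower.toAlgHom k R[X] B) ≫ Sp.map CAlgHom ≫ q)
        (gl (algebraMap R[X] B X)))
    {R' : Type u} [CommRing R'] [Algebra k R'] {φ : R →ₐ[k] R'}
    (hconst : ConstAlong f (Sp.map φ ≫ q)) (x : A) {n m : ℕ} {p : R[X]} (hmn : m < n)
    (hp : g x - algebraMap R[X] B (C (σ (g x))) - algebraMap R[X] B p ∈ RingHom.ker σ.toRingHom ^ n) :
    φ (p.coeff m) = 0 := by
  obtain ⟨n, rfl⟩ : ∃ n', n = n' + 1 := ⟨n - 1, by omega⟩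
  obtain ⟨ψ, hψ⟩ := exists_jet σ.toRingHom hσ n
  let Q := R'[X] ⧸ Ideal.span {(X : R'[X]) ^ (n + 1)}
  let π : (R[X] ⧸ Ideal.span {(X : R[X]) ^ (n + 1)}) →+* Q :=
    Ideal.quotientMap _ (mapRingHom φ.toRingHom) (by
      rw [Ideal.span_singleton_le_iff_mem, Ideal.mem_comap, Ideal.mem_span_singleton]
      simp)
  let ι : R' →ₐ[k] Q := (Ideal.Quotient.mkₐ k _).comp CAlgHom
  let Ψ : B →ₐ[k] Q := { π.comp ψ.toRingHom with
    commutes' := fun c => by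
      change π (ψ (algebraMap k B c)) = algebraMap k Q c
      rw [IsScalarTower.algebraMap_apply k R[X] B, ψ.commutes]
      change Ideal.Quotient.mk _ ((C (algebraMap k R c)).map φ.toRingHom) =
        Ideal.Quotient.mk _ (C (algebraMap k R' c))
      rw [map_C]
      exact congrArg _ (congrArg _ (φ.commutes c)) }
  have hΨ : ∀ (b : B) (r : R[X]), ψ b = Ideal.Quotient.mk _ r →
      Ψ b = Ideal.Quotient.mk _ (r.map φ.toRingHom) := fun b r h => congrArg π h
  have hΨp : ∀ r : R[X], Ψ (algebraMap R[X] B r) = Ideal.Quotient.mk _ (r.map φ.toRingHom) :=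
    fun r => hΨ _ r (ψ.commutes r)
  let ρ : Q →ₐ[k] R' := Ideal.Quotient.liftₐ _ (polyHom (AlgHom.id k R') 0) (by
    intro r hr
    rw [Ideal.mem_span_singleton] at hr
    obtain ⟨c, rfl⟩ := hr
    rw [map_mul, map_pow, polyHom_X, zero_pow (by omega), zero_mul])
  have hρ : ∀ r : R'[X], ρ (Ideal.Quotient.mk _ r) = r.coeff 0 := fun r => by
    change polyHom (AlgHom.id k R') 0 r = _
    rw [polyHom_apply, coeff_zero_eq_eval_zero]
    rfl
  have : Surjective (Sp.map ρ).left := by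
    refine Sp.map_surjective ρ (fun r => ⟨Ideal.Quotient.mk _ (C r), by rw [hρ, coeff_C_zero]⟩) ?_
    intro y hy
    obtain ⟨r, rfl⟩ := Ideal.Quotient.mk_surjective y
    rw [hρ, ← X_dvd_iff] at hy
    refine ⟨n + 1, ?_⟩
    rw [← map_pow, Ideal.Quotient.eq_zero_iff_mem, Ideal.mem_span_singleton]
    exact pow_dvd_pow_of_dvd hy _
  have hcomp : Ψ.comp g = (ι.comp φ).comp (σ.comp g) := by
    have hmaps : Sp.map (Ψ.comp g) = Sp.map ((ι.comp φ).comp (σ.comp g)) := by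
      refine hu.hom_ext (Sp.map ρ) _ _ ?_ ?_
      · have h1 : (Ψ.comp (IsScalarTower.toAlgHom k R[X] B)).comp CAlgHom = ι.comp φ :=
          AlgHom.ext fun r => (hΨp (C r)).trans (by rw [map_C]; rfl)
        rw [Sp.map_comp, op_comp, Functor.map_comp_apply, hg, map_evalAt, Sp.map_comp, op_comp,
          Functor.map_comp_apply, map_section_comp hσ hg, map_evalAt, map_zero, ← Category.assoc,
          ← Category.assoc, ← Sp.map_comp, ← Sp.map_comp, h1, Sp.map_comp, Category.assoc]
        exact hconst _ _ _
      · rw [← Sp.map_comp, ← Sp.map_comp]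
        congr 1
        ext y
        obtain ⟨r, hr⟩ := Ideal.Quotient.mk_surjective (ψ (g y))
        change ρ (Ψ (g y)) = ρ (ι (φ (σ (g y))))
        rw [hΨ _ r hr.symm, hρ, coeff_map]
        change _ = ρ (Ideal.Quotient.mk _ (C (φ (σ (g y)))))
        rw [hρ, coeff_C_zero]
        exact congrArg φ (hψ _ r hr.symm).symm
    obtain h := Spec.map_injective (congrArg (·.left) hmaps)
    ext y
    exact ConcreteCategory.congr_hom h y
  have hzero := jet_eq_zero σ.toRingHom ψ hψ hp
  have h2 : Ψ (algebraMap R[X] B p) = 0 := by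
    have h3 : Ψ (g x - algebraMap R[X] B (C (σ (g x))) - algebraMap R[X] B p) = 0 := by
      change π (ψ _) = 0
      rw [hzero, map_zero]
    have h4 : Ψ (g x) = Ψ (algebraMap R[X] B (C (σ (g x)))) := by
      rw [hΨp, map_C]
      exact congrArg (· x) hcomp
    rw [map_sub, map_sub, h4, sub_self, zero_sub, neg_eq_zero] at h3
    exact h3
  rw [hΨp, Ideal.Quotient.eq_zero_iff_mem, Ideal.mem_span_singleton, X_pow_dvd_iff] at h2
  have := h2 m hmn
  rwa [coeff_map] at this

/-- The locus where a family of maps `𝔸¹ → Z`, given on a neighbourhood of the zero section by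
functions on a chart, is constant is closed and cut out by finitely many equations. -/
theorem exists_fg_constAlong_iff
    (hZ : Presheaf.IsSheaf (Scheme.etaleTopology.over (Spec (CommRingCat.of k))) Z)
    {a : GmAction Z} {n : ℤ} (hn : n * n = 1) (hf : IsEquivariant (lineAction k n) a f)
    [Algebra.Etale R[X] B] [Algebra.FiniteType k A] (hu : IsEtaleSection u₀)
    (hσ : ∀ p, σ (algebraMap R[X] B p) = p.coeff 0)
    (hg : Z.map (Sp.map g).op u₀ =
      evalAt f (Sp.map (IsScalarTower.toAlgHom k R[X] B) ≫ Sp.map CAlgHom ≫ q)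
        (gl (algebraMap R[X] B X))) :
    ∃ I : Ideal R, I.FG ∧ ∀ (R' : Type u) [CommRing R'] [Algebra k R'] (φ : R →ₐ[k] R'),
      ConstAlong f (Sp.map φ ≫ q) ↔ ∀ r ∈ I, φ r = 0 := by
  obtain ⟨s, hs⟩ := Algebra.FiniteType.out (R := k) (A := A)
  let b : s → B := fun x => g x - algebraMap R[X] B (C (σ (g x)))
  obtain ⟨hfg, h, hh, hhb⟩ := taylorIdeal_fg σ.toRingHom hσ b
  refine ⟨taylorIdeal σ.toRingHom b, hfg, fun R' _ _ φ => ⟨fun hconst r hr => ?_, fun hI => ?_⟩⟩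
  · have : taylorIdeal σ.toRingHom b ≤ RingHom.ker φ.toRingHom := by
      refine Ideal.span_le.mpr ?_
      rintro _ ⟨i, n, m, p, hmn, hp, rfl⟩
      exact hconst.map_coeff_eq_zero hu hσ hg i hmn hp
    exact this hr
  · refine constAlong_of_nhd_zero hZ hn hf _ fun t => ?_
    let Bh := Localization.Away h
    let _ : Algebra k Bh := inferInstance
    let ℓ : B →ₐ[k] Bh := IsScalarTower.toAlgHom k B Bh
    let θ : R[X] →ₐ[k] Bh := ℓ.comp (IsScalarTower.toAlgHom k R[X] B)
    have hθ : Etale (Sp.map θ).left := by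
      refine Sp.map_etale ?_
      refine RingHom.Etale.stableUnderComposition _ _ (RingHom.etale_algebraMap.mpr inferInstance)
        (RingHom.etale_algebraMap (R := B) (S := Bh).mpr (Algebra.Etale.of_isLocalizationAway h))
    let σh : Bh →+* R := IsLocalization.Away.lift (g := σ.toRingHom) h (by rw [hh]; exact isUnit_one)
    have hσh : ∀ y, σh (algebraMap B Bh y) = σ y := fun y => IsLocalization.Away.lift_eq _ _ _
    let τ : R[X] →ₐ[k] R'[X] := mapAlgHom φ
    let z : PrimeSpectrum Bh := PrimeSpectrum.comap (φ.toRingHom.comp σh) t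
    have hz : (Sp.map τ).left ((Sp.map (polyHom (AlgHom.id k R') 0)).left t) = (Sp.map θ).left z := by
      apply PrimeSpectrum.ext
      ext p
      have h1 : polyHom (AlgHom.id k R') 0 (τ p) = φ (p.coeff 0) := by
        rw [polyHom_apply]
        change ((p.map φ.toRingHom).eval 0) = _
        rw [← coeff_zero_eq_eval_zero, coeff_map]
        rfl
      have h2 : φ (σh (θ p)) = φ (p.coeff 0) := congrArg φ ((hσh _).trans (hσ p))
      have h3 : polyHom (AlgHom.id k R') 0 (τ p) = φ (σh (θ p)) := h1.trans h2.symm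
      exact iff_of_eq (congrArg (· ∈ PrimeSpectrum.asIdeal (R := R') t) h3)
    obtain ⟨W, α, β, w, hαβ, hα, hαw, -⟩ := exists_etale_pullback (Sp.map τ) (Sp.map θ) _ z hz
    refine ⟨W, α, hα, ⟨w, hαw⟩, ?_⟩
    let γ : W ⟶ Sp k B := β ≫ Sp.map ℓ
    have hγ : α ≫ Sp.map τ = γ ≫ Sp.map (IsScalarTower.toAlgHom k R[X] B) := by
      rw [hαβ, Category.assoc, ← Sp.map_comp]
    have hτ : τ.comp CAlgHom = CAlgHom.comp φ := AlgHom.ext fun r => map_C φ.toRingHom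
    have hs1 : α ≫ Sp.map CAlgHom ≫ Sp.map φ ≫ q =
        γ ≫ Sp.map (IsScalarTower.toAlgHom k R[X] B) ≫ Sp.map CAlgHom ≫ q := by
      rw [← Category.assoc γ, ← hγ, Category.assoc, ← Category.assoc (Sp.map τ), ← Sp.map_comp, hτ,
        Sp.map_comp, Category.assoc]
    have hpull : ∀ r : R[X], α.left.appTop (gl (τ r)) = γ.left.appTop (gl (algebraMap R[X] B r)) := by
      intro r
      have h1 : (α ≫ Sp.map τ).left.appTop (gl r) =
          (γ ≫ Sp.map (IsScalarTower.toAlgHom k R[X] B)).left.appTop (gl r) := by rw [hγ]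
      rw [Sp.comp_map_appTop_gl, Sp.comp_map_appTop_gl] at h1
      exact h1
    have hX : α.left.appTop (gl X) = γ.left.appTop (gl (algebraMap R[X] B X)) := by
      rw [← hpull, show τ X = X from map_X φ.toRingHom]
    -- on `W`, the coordinates of `f` agree with their values on the zero section
    let F : B →+* Γ(W.left, ⊤) := γ.left.appTop.hom.comp gl
    have hF : ∀ y, F y = β.left.appTop (gl (ℓ y)) := fun y => by
      change γ.left.appTop (gl y) = _
      rw [Sp.comp_map_appTop_gl]
    have hFh : IsUnit (F h) := by
      rw [hF]
      exact (IsLocalization.Away.algebraMap_isUnit (S := Bh) h).map (β.left.appTop.hom.comp gl)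
    have hFI : (taylorIdeal σ.toRingHom b).map ((algebraMap R[X] B).comp C) ≤ RingHom.ker F := by
      rw [Ideal.map_le_iff_le_comap]
      intro r hr
      rw [Ideal.mem_comap, RingHom.mem_ker]
      refine (hpull (C r)).symm.trans ?_
      rw [show τ (C r) = C (φ r) from map_C φ.toRingHom, hI r hr, C_0, map_zero, map_zero]
    have hFg : ∀ x : A, F (g x) = F (algebraMap R[X] B (C (σ (g x)))) := by
      intro x
      have hx : x ∈ Algebra.adjoin k (s : Set A) := hs ▸ Algebra.mem_top
      induction hx using Algebra.adjoin_induction with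
      | mem x hx =>
        have h1 : F h * F (b ⟨x, hx⟩) = 0 := by rw [← map_mul]; exact hFI (hhb ⟨x, hx⟩)
        rw [hFh.mul_right_eq_zero] at h1
        rw [← sub_eq_zero, ← map_sub]
        exact h1
      | algebraMap c =>
        rw [AlgHom.commutes, AlgHom.commutes, IsScalarTower.algebraMap_apply k R[X] B]
        rfl
      | add x y _ _ hx hy => simp only [map_add, hx, hy]
      | mul x y _ _ hx hy => simp only [map_mul, hx, hy]
    have hlift : γ ≫ Sp.map g = γ ≫ Sp.map (IsScalarTower.toAlgHom k R[X] B) ≫ Sp.map CAlgHom ≫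
        Sp.map (σ.comp g) := by
      refine Sp.hom_ext fun x => ?_
      rw [← Sp.map_comp, ← Sp.map_comp]
      have h1 := Sp.comp_map_appTop_gl γ g x
      have h2 := Sp.comp_map_appTop_gl γ
        ((IsScalarTower.toAlgHom k R[X] B).comp (CAlgHom.comp (σ.comp g))) x
      exact h1.trans ((hFg x).trans h2.symm)
    have h1 := congrArg (Z.map γ.op) hg
    have h2 := congrArg (Z.map (γ ≫ Sp.map (IsScalarTower.toAlgHom k R[X] B) ≫ Sp.map CAlgHom).op)
      (map_section_comp hσ hg)
    rw [map_evalAt, ← Functor.map_comp_apply, ← op_comp] at h1 h2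
    rw [hs1, hX, ← h1, hlift]
    simp only [map_zero, Category.assoc] at h2
    exact h2

end

/-! ### Existence of charts -/

section

open Polynomial TensorProduct

theorem exists_etale_pushout_of_algebra {Λ Λ' B C : Type u} [CommRing Λ] [CommRing Λ'] [CommRing B]
    [CommRing C] [Algebra Λ Λ'] [Algebra Λ B] [Algebra.Etale Λ B] [Algebra Λ C] (f : Λ' →ₐ[Λ] C)
    (τ : B →ₐ[Λ] C) :
    ∃ (B' : Type u) (_ : CommRing B') (ι₁ : Λ' →+* B') (ι₂ : B →+* B') (σ : B' →+* C),
      ι₁.Etale ∧ ι₁.comp (algebraMap Λ Λ') = ι₂.comp (algebraMap Λ B) ∧ σ.comp ι₁ = f ∧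
      σ.comp ι₂ = τ := by
  refine ⟨Λ' ⊗[Λ] B, inferInstance, algebraMap Λ' _,
    (Algebra.TensorProduct.includeRight : B →ₐ[Λ] Λ' ⊗[Λ] B),
    (Algebra.TensorProduct.productMap f τ : Λ' ⊗[Λ] B →ₐ[Λ] C),
    RingHom.etale_algebraMap.mpr inferInstance, ?_, ?_, ?_⟩
  · ext x
    change algebraMap Λ Λ' x ⊗ₜ[Λ] (1 : B) = 1 ⊗ₜ[Λ] algebraMap Λ B x
    rw [Algebra.algebraMap_eq_smul_one, Algebra.algebraMap_eq_smul_one, TensorProduct.smul_tmul]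
  · ext x
    exact Algebra.TensorProduct.productMap_left_apply f τ x
  · ext x
    exact Algebra.TensorProduct.productMap_right_apply f τ x

theorem exists_etale_pushout {Λ Λ' B C : Type u} [CommRing Λ] [CommRing Λ'] [CommRing B]
    [CommRing C] (φ : Λ →+* Λ') (e : Λ →+* B) (he : e.Etale) (f : Λ' →+* C) (τ : B →+* C)
    (h : f.comp φ = τ.comp e) :
    ∃ (B' : Type u) (_ : CommRing B') (ι₁ : Λ' →+* B') (ι₂ : B →+* B') (σ : B' →+* C),
      ι₁.Etale ∧ ι₁.comp φ = ι₂.comp e ∧ σ.comp ι₁ = f ∧ σ.comp ι₂ = τ := by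
  let _ : Algebra Λ Λ' := φ.toAlgebra
  let _ : Algebra Λ B := e.toAlgebra
  let _ : Algebra Λ C := (τ.comp e).toAlgebra
  have : Algebra.Etale Λ B := he
  let f' : Λ' →ₐ[Λ] C := { f with commutes' := fun x => congrArg (· x) h }
  let τ' : B →ₐ[Λ] C := { τ with commutes' := fun _ => rfl }
  exact exists_etale_pushout_of_algebra f' τ'

/-- The base change of an étale algebra `B` over `R[X]` to `R'[X]` has a point over the zero section
if `R'` receives a compatible homomorphism from `B`. -/
theorem exists_baseChange_section {R R' B : Type u} [CommRing R] [CommRing R'] [CommRing B]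
    [Algebra k R] [Algebra k R'] [Algebra k B] (φ : R →ₐ[k] R') (e : R[X] →ₐ[k] B)
    (he : e.toRingHom.Etale) (τ : B →ₐ[k] R') (hτ : ∀ p, τ (e p) = φ (p.coeff 0)) :
    ∃ (B' : Type u) (_ : CommRing B') (_ : Algebra k B') (_ : Algebra R'[X] B')
      (_ : IsScalarTower k R'[X] B') (_ : Algebra.Etale R'[X] B') (σ : B' →ₐ[k] R')
      (ι : B →ₐ[k] B'), (∀ p, σ (algebraMap R'[X] B' p) = p.coeff 0) ∧
      ∀ p, ι (e p) = algebraMap R'[X] B' (p.map φ.toRingHom) := by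
  obtain ⟨B', _, ι₁, ι₂, σ, hι₁, hι, hσ, -⟩ := exists_etale_pushout (mapRingHom φ.toRingHom)
    e.toRingHom he (evalRingHom 0) τ.toRingHom (by
      refine RingHom.ext fun p => ?_
      change (p.map φ.toRingHom).eval 0 = τ (e p)
      rw [← coeff_zero_eq_eval_zero, coeff_map, hτ]
      rfl)
  have hσ' : ∀ p, σ (ι₁ p) = p.coeff 0 := fun p =>
    (congrArg (· p) hσ).trans (coeff_zero_eq_eval_zero p).symm
  have hι' : ∀ p, ι₂ (e p) = ι₁ (p.map φ.toRingHom) := fun p => (congrArg (· p) hι).symm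
  let _ : Algebra R'[X] B' := ι₁.toAlgebra
  let _ : Algebra k B' := (ι₁.comp (algebraMap k R'[X])).toAlgebra
  refine ⟨B', inferInstance, inferInstance, inferInstance,
    IsScalarTower.of_algebraMap_eq fun _ => rfl, hι₁,
    { σ with commutes' := fun c => (hσ' (C (algebraMap k R' c))).trans coeff_C_zero },
    { ι₂ with commutes' := fun c => ?_ }, hσ', hι'⟩
  change ι₂ (algebraMap k B c) = ι₁ (C (algebraMap k R' c))
  rw [← e.commutes, hι']
  congr 1
  change (C (algebraMap k R c)).map φ.toRingHom = C (algebraMap k R' c)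
  rw [map_C]
  exact congrArg C (φ.commutes c)

end

theorem exists_affine_nhd (T : Sch k) (t : T.left) :
    ∃ (R : Type u) (_ : CommRing R) (_ : Algebra k R) (q : Sp k R ⟶ T), IsOpenImmersion q.left ∧
      t ∈ Set.range q.left := by
  obtain ⟨R, j, hj, ht, -⟩ := T.left.exists_affine_mem_range_and_range_subset (x := t) (U := ⊤) trivial
  obtain ⟨φ, hφ⟩ := Spec.map_surjective (j ≫ T.hom)
  let _ : Algebra k R := φ.hom.toAlgebra
  exact ⟨R, inferInstance, inferInstance, Over.homMk j hφ.symm, hj, ht⟩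

theorem Sp.algebra_etale {R R' : Type u} [CommRing R] [CommRing R'] [Algebra k R] [Algebra k R']
    {φ : R →ₐ[k] R'} (h : Etale (Sp.map φ).left) : φ.toRingHom.Etale :=
  HasRingHomProperty.Spec_iff.mp h

theorem Sp.finiteType_of_comp {A : Type u} [CommRing A] [Algebra k A] {U : Sch k}
    [LocallyOfFiniteType U.hom] (j : Sp k A ⟶ U) [IsOpenImmersion j.left] :
    Algebra.FiniteType k A := by
  have h : LocallyOfFiniteType (j.left ≫ U.hom) := inferInstance
  rw [Over.w j] at h
  have h' : (algebraMap k A).FiniteType :=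
    HasRingHomProperty.Spec_iff (P := @LocallyOfFiniteType).mp h
  exact RingHom.finiteType_algebraMap.mp h'

/-- Étale locally on the base `S`, the locus where an equivariant family of maps `𝔸¹ → Z` is
constant is defined by a finitely generated ideal, and the values of the family
at zero lift to an affine étale chart. -/
theorem exists_chart {Z : PreSpace k} (hZ : IsAlgebraicSpace Z) (hft : IsFiniteType Z)
    {S : Sch k} {a : GmAction Z} {n : ℤ} (hn : n * n = 1) {f : Z.obj (op (S ⊗ affineLine k))}
    (hf : IsEquivariant (lineAction k n) a f) (s : S.left) :
    ∃ (R : Type u) (_ : CommRing R) (_ : Algebra k R) (q : Sp k R ⟶ S), Etale q.left ∧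
      s ∈ Set.range q.left ∧
      (∃ I : Ideal R, I.FG ∧ ∀ (R' : Type u) [CommRing R'] [Algebra k R'] (φ : R →ₐ[k] R'),
        ConstAlong f (Sp.map φ ≫ q) ↔ ∀ r ∈ I, φ r = 0) ∧
      ∃ (A : Type u) (_ : CommRing A) (_ : Algebra k A) (u₀ : Z.obj (op (Sp k A)))
        (w : A →ₐ[k] R), IsEtaleSection u₀ ∧ Z.map (Sp.map w).op u₀ = evalAt f q 0 := by
  obtain ⟨U, v, hv, hU, -⟩ := hft
  let u : Z.obj (op U) := yonedaEquiv v
  have huv : yonedaEquiv.symm u = v := yonedaEquiv.symm_apply_apply v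
  have hu : IsEtaleSection u := by rw [IsEtaleSection, huv]; exact hv.etale
  obtain ⟨R, _, _, q, hq, s₀, rfl⟩ := exists_affine_nhd S s
  -- an étale neighbourhood of the zero section at `s` which maps to an affine chart
  obtain ⟨W, p, r, hp, hrp, hps, -⟩ := hu.exists_pullback
    (evalAt f (Sp.map Polynomial.CAlgHom ≫ q) (gl Polynomial.X))
  have hps := hps (by rw [huv]; exact hv.surjective)
  obtain ⟨w, hw⟩ := hps.surj ((Sp.map (polyHom (AlgHom.id k R) 0)).left s₀)
  obtain ⟨A, _, _, j, hj, y, hy⟩ := exists_affine_nhd U (r.left w)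
  have := Sp.finiteType_of_comp j
  obtain ⟨W₁, α, β, w₁, hαβ, hα, hαw, -⟩ := exists_etale_pullback r j w y hy.symm
  obtain ⟨B, _, _, i, hi, b, rfl⟩ := exists_affine_nhd W₁ w₁
  obtain ⟨e, he⟩ := Sp.exists_map_eq (i ≫ α ≫ p)
  obtain ⟨g, hg⟩ := Sp.exists_map_eq (i ≫ β)
  have he' : Etale (Sp.map e).left := by
    rw [← he]
    exact inferInstanceAs (Etale (i.left ≫ α.left ≫ p.left))
  have hb : (Sp.map (polyHom (AlgHom.id k R) 0)).left s₀ = (Sp.map e).left b := by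
    rw [← hw, ← hαw, ← he]
    rfl
  have hgu : Z.map (Sp.map g).op (Z.map j.op u) =
      evalAt f (Sp.map e ≫ Sp.map Polynomial.CAlgHom ≫ q) (gl (e Polynomial.X)) := by
    rw [← Sp.map_appTop_gl, ← map_evalAt, ← he, ← hg, ← Functor.map_comp_apply, ← op_comp,
      Category.assoc, ← hαβ, op_comp, op_comp, Functor.map_comp_apply, Functor.map_comp_apply, hrp,
      ← Functor.map_comp_apply, ← Functor.map_comp_apply, ← op_comp, ← op_comp]
    rfl
  -- base change to make the zero section lift to the étale neighbourhood
  obtain ⟨T, γ, δ, t, hγδ, hγ, hγt, -⟩ := exists_etale_pullback _ _ s₀ b hb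
  obtain ⟨R₁, _, _, c, hc, t₁, rfl⟩ := exists_affine_nhd T t
  obtain ⟨φ, hφ⟩ := Sp.exists_map_eq (c ≫ γ)
  obtain ⟨τ, hτ⟩ := Sp.exists_map_eq (c ≫ δ)
  have hcompat : ∀ x, τ (e x) = φ (x.coeff 0) := by
    have h1 : Sp.map (τ.comp e) = Sp.map (φ.comp (polyHom (AlgHom.id k R) 0)) := by
      rw [Sp.map_comp, Sp.map_comp, ← hφ, ← hτ, Category.assoc, Category.assoc, hγδ]
    intro x
    have h2 := ConcreteCategory.congr_hom (Spec.map_injective (congrArg (·.left) h1)) x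
    refine Eq.trans h2 (congrArg φ ?_)
    rw [Polynomial.coeff_zero_eq_eval_zero]
    rfl
  obtain ⟨B', _, _, _, _, _, σ, ι, hσ, hι⟩ :=
    exists_baseChange_section φ e (Sp.algebra_etale he') τ hcompat
  have hφ' : Etale (Sp.map φ).left := by
    rw [← hφ]
    exact inferInstanceAs (Etale (c.left ≫ γ.left))
  have hg' : Z.map (Sp.map (ι.comp g)).op (Z.map j.op u) =
      evalAt f (Sp.map (IsScalarTower.toAlgHom k (Polynomial R₁) B') ≫ Sp.map Polynomial.CAlgHom ≫
        Sp.map φ ≫ q) (gl (algebraMap (Polynomial R₁) B' Polynomial.X)) := by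
    have h1 : (ι.comp e).comp Polynomial.CAlgHom =
        ((IsScalarTower.toAlgHom k (Polynomial R₁) B').comp Polynomial.CAlgHom).comp φ :=
      AlgHom.ext fun x => (hι (Polynomial.C x)).trans (by rw [Polynomial.map_C]; rfl)
    have h2 : ι (e Polynomial.X) = algebraMap (Polynomial R₁) B' Polynomial.X :=
      (hι _).trans (by rw [Polynomial.map_X])
    rw [Sp.map_comp, op_comp, Functor.map_comp_apply, hgu, map_evalAt, Sp.map_appTop_gl, h2]
    congr 1
    simp only [← Category.assoc, ← Sp.map_comp]
    exact congrArg (Sp.map · ≫ q) h1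
  have hu' : IsEtaleSection (Z.map j.op u) := hu.map j
  refine ⟨R₁, inferInstance, inferInstance, Sp.map φ ≫ q,
    inferInstanceAs (Etale ((Sp.map φ).left ≫ q.left)), ⟨t₁, ?_⟩,
    exists_fg_constAlong_iff hZ.isSheaf hn hf hu' hσ hg',
    A, inferInstance, inferInstance, Z.map j.op u, σ.comp (ι.comp g), hu', map_section_comp hσ hg'⟩
  rw [← hφ, ← hγt]
  rfl

/-! ### Families of maps which agree at the point `1` -/

section

open Polynomial LaurentPolynomial

theorem coeff_eval₂_T {R : Type u} [CommRing R] {e : ℤ} (he : e ≠ 0) (p : R[X]) (n : ℕ) :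
    (p.eval₂ LaurentPolynomial.C (T e)).coeff (n * e) = p.coeff n := by
  induction p using Polynomial.induction_on' with
  | add p q hp hq => rw [eval₂_add, AddMonoidAlgebra.coeff_add, Finsupp.add_apply, hp, hq, coeff_add]
  | monomial m r =>
    rw [eval₂_monomial, T_pow, ← single_eq_C_mul_T, AddMonoidAlgebra.coeff_single, coeff_monomial,
      Finsupp.single_apply]
    simp [he]

theorem coeff_eval₂_T_eq_zero {R : Type u} [CommRing R] {e : ℤ} (p : R[X]) {z : ℤ}
    (hz : ∀ n : ℕ, n * e ≠ z) : (p.eval₂ LaurentPolynomial.C (T e)).coeff z = 0 := by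
  induction p using Polynomial.induction_on' with
  | add p q hp hq => rw [eval₂_add, AddMonoidAlgebra.coeff_add, Finsupp.add_apply, hp, hq, add_zero]
  | monomial m r =>
    rw [eval₂_monomial, T_pow, ← single_eq_C_mul_T, AddMonoidAlgebra.coeff_single,
      Finsupp.single_apply, if_neg (hz m)]

/-- A Laurent polynomial which is both a polynomial in `T` and a polynomial in `T⁻¹` is constant. -/
theorem eq_C_of_eval₂_T_eq {R : Type u} [CommRing R] {e e' : ℤ} (he : e * e' < 0) (p q : R[X])
    (h : p.eval₂ LaurentPolynomial.C (T e) = q.eval₂ LaurentPolynomial.C (T e')) :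
    p = Polynomial.C (p.coeff 0) := by
  have he0 : e ≠ 0 := by rintro rfl; simp at he
  ext n
  rw [coeff_C]
  split_ifs with hn
  · rw [hn]
  · rw [← coeff_eval₂_T he0 p n, h]
    refine coeff_eval₂_T_eq_zero q fun m hm => ?_
    have h1 : (m : ℤ) * (e' * e') = n * (e * e') := by linear_combination e' * hm
    have h2 : (n : ℤ) * (e * e') < 0 := mul_neg_of_pos_of_neg (by omega) he
    have h3 : 0 ≤ (m : ℤ) * (e' * e') := mul_nonneg (by omega) (mul_self_nonneg _)
    omega

variable {Z : PreSpace k} {S : Sch k} {a : GmAction Z}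
  {R : Type u} [CommRing R] [Algebra k R] {q : Sp k R ⟶ S}
  {A : Type u} [CommRing A] [Algebra k A] {u₀ : Z.obj (op (Sp k A))}

/-- The `k`-algebra homomorphism `R → R[T;T⁻¹]`. -/
noncomputable def laurentC (k R : Type u) [Field k] [CommRing R] [Algebra k R] : R →ₐ[k] R[T;T⁻¹] :=
  { LaurentPolynomial.C with commutes' := fun _ => rfl }

/-- If `f` lifts to `g : A → R[X]`, then its restriction to the units of the line is the orbit
`f (Tⁿ) = T · f (1)`. The condition on `n` says that `n = ±1`, so that `T = (Tⁿ)ⁿ`. -/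
theorem map_polyHom_laurent {n : ℤ} (hn : n * n = 1) {f : Z.obj (op (S ⊗ affineLine k))}
    (hf : IsEquivariant (lineAction k n) a f) {g : A →ₐ[k] R[X]}
    (hg : Z.map (Sp.map g).op u₀ = evalAt f (Sp.map CAlgHom ≫ q) (gl X))
    (c : (Γ((Sp k R[T;T⁻¹]).left, ⊤))ˣ) (hc : (c : Γ((Sp k R[T;T⁻¹]).left, ⊤)) = gl (T 1)) :
    Z.map (Sp.map ((polyHom (laurentC k R) (T n)).comp g)).op u₀ =
      a.act _ c (evalAt f (Sp.map (laurentC k R) ≫ q) 1) := by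
  have hT : gl (T n : R[T;T⁻¹]) = ((c ^ n : (Γ((Sp k R[T;T⁻¹]).left, ⊤))ˣ) :
      Γ((Sp k R[T;T⁻¹]).left, ⊤)) := by
    rcases Int.eq_one_or_neg_one_of_mul_eq_one hn with rfl | rfl
    · rw [zpow_one, hc]
    · rw [zpow_neg_one]
      refine Units.eq_inv_of_mul_eq_one_right ?_
      rw [hc, ← map_mul, ← T_add]
      exact map_one gl
  rw [← evalAt_mul hf, mul_one, ← hT, Sp.map_comp, op_comp, Functor.map_comp_apply, hg, map_evalAt,
    Sp.map_appTop_gl, polyHom_X, ← Category.assoc, ← Sp.map_comp, polyHom_comp_CAlgHom]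

theorem constAlong_of_eq_C {f : Z.obj (op (S ⊗ affineLine k))} {g : A →ₐ[k] R[X]}
    (hg : Z.map (Sp.map g).op u₀ = evalAt f (Sp.map CAlgHom ≫ q) (gl X))
    (hC : ∀ x, g x = Polynomial.C ((g x).coeff 0)) : ConstAlong f q := by
  rw [constAlong_Sp_iff, ← hg]
  have h1 : g = (polyHom CAlgHom 0 : R[X] →ₐ[k] R[X]).comp g := by
    ext1 x
    rw [AlgHom.comp_apply, hC x, polyHom_C]
    rfl
  rw [h1, Sp.map_comp, op_comp, Functor.map_comp_apply, hg, map_evalAt, Sp.map_appTop_gl, polyHom_X,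
    ← Category.assoc, ← Sp.map_comp, polyHom_comp_CAlgHom, map_zero]

/-- Suppose that two equivariant families of maps `f : 𝔸¹ → Z` and `f' : 𝔸¹₋ → Z` agree at `1` and
both lift to the same chart. Then both are constant, since `f (t) = t · f (1)` and
`f' (t) = t⁻¹ · f' (1)`. -/
theorem constAlong_of_lifts {f f' : Z.obj (op (S ⊗ affineLine k))}
    (hf : IsEquivariant (lineAction k 1) a f) (hf' : IsEquivariant (lineAction k (-1)) a f')
    (h1 : ∀ (T : Sch k) (s : T ⟶ S), evalAt f s 1 = evalAt f' s 1) {g g' : A →ₐ[k] R[X]}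
    (hg : Z.map (Sp.map g).op u₀ = evalAt f (Sp.map CAlgHom ≫ q) (gl X))
    (hg' : Z.map (Sp.map g').op u₀ = evalAt f' (Sp.map CAlgHom ≫ q) (gl X))
    (hsep : Z.map (Sp.map ((polyHom (laurentC k R) (T 1)).comp g)).op u₀ =
      Z.map (Sp.map ((polyHom (laurentC k R) (T (-1))).comp g')).op u₀ →
      ∀ x, polyHom (laurentC k R) (T 1) (g x) = polyHom (laurentC k R) (T (-1)) (g' x)) :
    ConstAlong f q ∧ ConstAlong f' q := by
  obtain ⟨c, hc⟩ : IsUnit (gl (T 1 : R[T;T⁻¹]) : Γ((Sp k R[T;T⁻¹]).left, ⊤)) := (isUnit_T 1).map gl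
  have h := hsep (by
    rw [map_polyHom_laurent (by norm_num) hf hg c hc,
      map_polyHom_laurent (by norm_num) hf' hg' c hc, h1])
  exact ⟨constAlong_of_eq_C hg fun x => eq_C_of_eval₂_T_eq (by norm_num) _ _ (h x),
    constAlong_of_eq_C hg' fun x => eq_C_of_eval₂_T_eq (by norm_num) _ _ (h x).symm⟩

end

/-! ### Infinitesimal deformations of constant families -/

theorem Sp.map_injective {R R' : Type u} [CommRing R] [CommRing R'] [Algebra k R] [Algebra k R']
    {φ ψ : R →ₐ[k] R'} (h : Sp.map φ = Sp.map ψ) : φ = ψ :=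
  AlgHom.ext fun x =>
    ConcreteCategory.congr_hom (Spec.map_injective (congrArg (·.left) h)) x

/-- The reduction of a homomorphism `R → E` modulo an ideal `I` of `R`. -/
noncomputable def reduction {R E : Type u} [CommRing R] [CommRing E] [Algebra k R] [Algebra k E]
    (I : Ideal R) (κ : R →ₐ[k] E) : (R ⧸ I) →ₐ[k] E ⧸ I.map κ.toRingHom :=
  Ideal.quotientMapₐ _ κ Ideal.le_comap_map

theorem reduction_comp_mkₐ {R E : Type u} [CommRing R] [CommRing E] [Algebra k R] [Algebra k E]
    (I : Ideal R) (κ : R →ₐ[k] E) :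
    (reduction I κ).comp (Ideal.Quotient.mkₐ k I) =
      (Ideal.Quotient.mkₐ k (I.map κ.toRingHom)).comp κ :=
  AlgHom.ext fun _ => rfl

theorem Sp.map_mkₐ_surjective {E : Type u} [CommRing E] [Algebra k E] {J : Ideal E}
    (hJ : IsNilpotent J) : Surjective (Sp.map (Ideal.Quotient.mkₐ k J)).left := by
  obtain ⟨n, hn⟩ := hJ
  refine Sp.map_surjective _ (Ideal.Quotient.mkₐ_surjective k J) fun x hx => ⟨n, ?_⟩
  have := Ideal.pow_mem_pow (Ideal.Quotient.eq_zero_iff_mem.mp hx) n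
  rw [hn] at this
  exact this

theorem isNilpotent_map {R E : Type u} [CommRing R] [CommRing E] {I : Ideal R} (hI : IsNilpotent I)
    (κ : R →+* E) : IsNilpotent (I.map κ) := by
  obtain ⟨n, hn⟩ := hI
  exact ⟨n, by rw [← Ideal.map_pow, hn, Ideal.zero_eq_bot, Ideal.map_bot]; rfl⟩

section

open Polynomial LaurentPolynomial

variable {Z : PreSpace k} {S : Sch k} {a : GmAction Z}
  {R : Type u} [CommRing R] [Algebra k R] {q : Sp k R ⟶ S}
  {A : Type u} [CommRing A] [Algebra k A] {u₀ : Z.obj (op (Sp k A))}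

/-- A family of maps `𝔸¹ → Z` whose reduction modulo a nilpotent ideal is constant with value in a
chart lifts to this chart. -/
theorem exists_lift_of_nilpotent (hu : IsEtaleSection u₀) {I : Ideal R} (hI : IsNilpotent I)
    {f : Z.obj (op (S ⊗ affineLine k))} (w : A →ₐ[k] R)
    (hf : ∀ (T : Sch k) (s : T ⟶ Sp k (R ⧸ I)) (v : Γ(T.left, ⊤)),
      evalAt f (s ≫ Sp.map (Ideal.Quotient.mkₐ k I) ≫ q) v =
        Z.map (s ≫ Sp.map (Ideal.Quotient.mkₐ k I) ≫ Sp.map w).op u₀) :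
    ∃ g : A →ₐ[k] R[X], Z.map (Sp.map g).op u₀ = evalAt f (Sp.map CAlgHom ≫ q) (gl X) ∧
      ∀ x, g x - Polynomial.C (w x) ∈ I.map (Polynomial.C : R →+* R[X]) := by
  let κ : R →ₐ[k] R[X] := CAlgHom
  have h1 := Sp.map_mkₐ_surjective (k := k) (isNilpotent_map hI κ.toRingHom)
  have h2 := Sp.map_isClosedImmersion (k := k) _
    (Ideal.Quotient.mkₐ_surjective k (I.map κ.toRingHom))
  obtain ⟨g, hg, hg'⟩ := hu.exists_lift (Sp.map (Ideal.Quotient.mkₐ k (I.map κ.toRingHom)))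
    (evalAt f (Sp.map CAlgHom ≫ q) (gl X))
    (Sp.map ((Ideal.Quotient.mkₐ k (I.map κ.toRingHom)).comp (κ.comp w))) (by
      have := hf _ (Sp.map (reduction I κ)) (gl (Ideal.Quotient.mkₐ k (I.map κ.toRingHom) X))
      simp only [← Category.assoc, ← Sp.map_comp, reduction_comp_mkₐ] at this
      rw [map_evalAt, Sp.map_appTop_gl, ← Category.assoc, ← Sp.map_comp]
      exact this.symm)
  obtain ⟨g, rfl⟩ := Sp.exists_map_eq g
  refine ⟨g, hg, fun x => ?_⟩
  rw [← Sp.map_comp] at hg'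
  have := congrArg (· x) (Sp.map_injective hg')
  exact Ideal.Quotient.eq.mp this

/-- If two families of maps `f : 𝔸¹ → Z` and `f' : 𝔸¹₋ → Z` which agree at `1` become constant modulo
a nilpotent ideal, then both are constant. -/
theorem constAlong_of_nilpotent (hu : IsEtaleSection u₀) {f f' : Z.obj (op (S ⊗ affineLine k))}
    (hf : IsEquivariant (lineAction k 1) a f) (hf' : IsEquivariant (lineAction k (-1)) a f')
    (h1 : ∀ (T : Sch k) (s : T ⟶ S), evalAt f s 1 = evalAt f' s 1)
    {I : Ideal R} (hI : IsNilpotent I) {w : A →ₐ[k] R}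
    (hw : Z.map (Sp.map w).op u₀ = evalAt f q 0)
    (hc : ConstAlong f (Sp.map (Ideal.Quotient.mkₐ k I) ≫ q))
    (hc' : ConstAlong f' (Sp.map (Ideal.Quotient.mkₐ k I) ≫ q)) :
    ConstAlong f q ∧ ConstAlong f' q := by
  have hval : ∀ (T : Sch k) (s : T ⟶ Sp k (R ⧸ I)) (v : Γ(T.left, ⊤)),
      evalAt f (s ≫ Sp.map (Ideal.Quotient.mkₐ k I) ≫ q) v =
        Z.map (s ≫ Sp.map (Ideal.Quotient.mkₐ k I) ≫ Sp.map w).op u₀ := by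
    intro T s v
    have h2 := congrArg (Z.map (s ≫ Sp.map (Ideal.Quotient.mkₐ k I)).op) hw
    rw [map_evalAt, map_zero, ← Functor.map_comp_apply, ← op_comp, Category.assoc,
      Category.assoc] at h2
    rw [h2]
    exact hc T s v
  obtain ⟨g, hg, hgw⟩ := exists_lift_of_nilpotent hu hI w hval
  obtain ⟨g', hg', hgw'⟩ := exists_lift_of_nilpotent hu hI (f := f') (q := q) w (by
    intro T s v
    rw [hc'.eq s v 1, ← h1, hval])
  refine constAlong_of_lifts hf hf' h1 hg hg' fun hlau => ?_
  have := Sp.map_mkₐ_surjective (k := k) (isNilpotent_map hI (laurentC k R).toRingHom)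
  have key : ∀ (n : ℤ) (p : R[X]), p ∈ I.map (Polynomial.C : R →+* R[X]) →
      polyHom (laurentC k R) (T n) p ∈ I.map (laurentC k R).toRingHom := by
    intro n p hp
    have h3 := Ideal.mem_map_of_mem (polyHom (laurentC k R) (T n)).toRingHom hp
    rw [Ideal.map_map] at h3
    have h4 : (polyHom (laurentC k R) (T n)).toRingHom.comp Polynomial.C =
        (laurentC k R).toRingHom := RingHom.ext fun r => polyHom_C _ _ r
    rw [h4] at h3
    exact h3
  have h5 := hu.hom_ext (Sp.map (Ideal.Quotient.mkₐ k (I.map (laurentC k R).toRingHom))) _ _ hlau (by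
    rw [← Sp.map_comp, ← Sp.map_comp]
    congr 1
    ext x
    refine Ideal.Quotient.eq.mpr ?_
    have h6 := sub_mem (key 1 _ (hgw x)) (key (-1) _ (hgw' x))
    rw [map_sub, map_sub, polyHom_C, polyHom_C] at h6
    rwa [sub_sub_sub_cancel_right] at h6)
  exact fun x => congrArg (· x) (Sp.map_injective h5)

end

/-! ### The locus of constancy is open and closed -/

/-- Étale locally on `S`, the locus where `f : 𝔸¹ → Z` and `f' : 𝔸¹₋ → Z`, which agree at `1`, are both
constant is defined by a finitely generated ideal `I`. As `f` and `f'` are then constant modulo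
`I ^ 2`, this ideal is generated by an idempotent. -/
theorem exists_isClopen_constAlong_iff {Z : PreSpace k} (hZ : IsAlgebraicSpace Z)
    (hft : IsFiniteType Z) {S : Sch k} {a : GmAction Z} {f f' : Z.obj (op (S ⊗ affineLine k))}
    (hf : IsEquivariant (lineAction k 1) a f) (hf' : IsEquivariant (lineAction k (-1)) a f')
    (h1 : ∀ (T : Sch k) (s : T ⟶ S), evalAt f s 1 = evalAt f' s 1) (s : S.left) :
    ∃ (S' : Sch k) (q : S' ⟶ S) (D : Set S'.left), Etale q.left ∧
      s ∈ Set.range q.left ∧ IsClopen D ∧ ∀ (T : Sch k) (g : T ⟶ S'),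
        ConstAlong f (g ≫ q) ∧ ConstAlong f' (g ≫ q) ↔ Set.range g.left ⊆ D := by
  obtain ⟨R₁, _, _, q₁, hq₁, ⟨s₁, hs₁⟩, ⟨I₁, hI₁, hc₁⟩, A, _, _, u₀, w, hu, hw⟩ :=
    exists_chart hZ hft (by norm_num) hf s
  obtain ⟨R₂, _, _, q₂, hq₂, ⟨s₂, hs₂⟩, ⟨I₂, hI₂, hc₂⟩, -⟩ := exists_chart hZ hft (by norm_num) hf' s
  obtain ⟨P, α, β, x, hαβ, hα, hx, -⟩ := exists_etale_pullback q₁ q₂ s₁ s₂ (hs₁.trans hs₂.symm)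
  obtain ⟨R, _, _, i, hi, t, rfl⟩ := exists_affine_nhd P x
  obtain ⟨φ₁, hφ₁⟩ := Sp.exists_map_eq (i ≫ α)
  obtain ⟨φ₂, hφ₂⟩ := Sp.exists_map_eq (i ≫ β)
  let q : Sp k R ⟶ S := Sp.map φ₁ ≫ q₁
  have hq : q = Sp.map φ₂ ≫ q₂ := by
    rw [← hφ₂, Category.assoc, ← hαβ, ← Category.assoc, hφ₁]
  have hqe : Etale q.left := by
    have : Etale (Sp.map φ₁).left := by
      rw [← hφ₁]
      exact inferInstanceAs (Etale (i.left ≫ α.left))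
    exact inferInstanceAs (Etale ((Sp.map φ₁).left ≫ q₁.left))
  have hqt : q.left t = s := by
    rw [← hs₁, ← hx]
    change (Sp.map φ₁ ≫ q₁).left t = _
    rw [← hφ₁]
    rfl
  let I : Ideal R := I₁.map φ₁.toRingHom ⊔ I₂.map φ₂.toRingHom
  have hIfg : I.FG := Submodule.FG.sup (hI₁.map _) (hI₂.map _)
  have hc : ∀ (R' : Type u) [CommRing R'] [Algebra k R'] (φ : R →ₐ[k] R'),
      (ConstAlong f (Sp.map φ ≫ q) ∧ ConstAlong f' (Sp.map φ ≫ q)) ↔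
        I ≤ RingHom.ker φ.toRingHom := by
    intro R' _ _ φ
    have e₁ : ConstAlong f (Sp.map φ ≫ q) ↔ I₁.map φ₁.toRingHom ≤ RingHom.ker φ.toRingHom := by
      rw [← Category.assoc, ← Sp.map_comp, hc₁, Ideal.map_le_iff_le_comap]
      rfl
    have e₂ : ConstAlong f' (Sp.map φ ≫ q) ↔ I₂.map φ₂.toRingHom ≤ RingHom.ker φ.toRingHom := by
      rw [hq, ← Category.assoc, ← Sp.map_comp, hc₂, Ideal.map_le_iff_le_comap]
      rfl
    rw [e₁, e₂, sup_le_iff]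
  -- `f` and `f'` are constant modulo `I ^ 2`
  have hIsq : I ≤ I ^ 2 := by
    let μ : R →ₐ[k] R ⧸ I ^ 2 := Ideal.Quotient.mkₐ k (I ^ 2)
    have hnil : IsNilpotent (I.map μ.toRingHom) :=
      ⟨2, by rw [← Ideal.map_pow]; exact Ideal.map_quotient_self _⟩
    have hker : I ≤ RingHom.ker ((Ideal.Quotient.mkₐ k (I.map μ.toRingHom)).comp μ).toRingHom :=
      fun r hr => Ideal.Quotient.eq_zero_iff_mem.mpr (Ideal.mem_map_of_mem _ hr)
    have h2 := (hc _ _).mpr hker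
    rw [Sp.map_comp, Category.assoc] at h2
    have hw' : Z.map (Sp.map ((μ.comp φ₁).comp w)).op u₀ = evalAt f (Sp.map μ ≫ q) 0 := by
      rw [Sp.map_comp, op_comp, Functor.map_comp_apply, hw, map_evalAt, map_zero, Sp.map_comp,
        Category.assoc]
    have h3 := (hc _ _).mp (constAlong_of_nilpotent hu hf hf' h1 hnil hw' h2.1 h2.2)
    exact fun r hr => Ideal.Quotient.eq_zero_iff_mem.mp (h3 hr)
  obtain ⟨e, he, hIe⟩ := (Ideal.isIdempotentElem_iff_of_fg I hIfg).mp
    (le_antisymm Ideal.mul_le_left (by rw [← pow_two]; exact hIsq))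
  refine ⟨Sp k R, q, PrimeSpectrum.zeroLocus {e}, hqe, ⟨t, hqt⟩, ?_, fun T g => ⟨?_, fun hD => ?_⟩⟩
  · exact PrimeSpectrum.isClopen_iff_zeroLocus.mpr ⟨e, he, rfl⟩
  · rintro ⟨h2, h3⟩ _ ⟨y, rfl⟩
    obtain ⟨R', _, _, j, hj, y, rfl⟩ := exists_affine_nhd T y
    obtain ⟨φ, hφ⟩ := Sp.exists_map_eq (j ≫ g)
    have h4 := (hc _ φ).mp (by
      rw [← hφ, Category.assoc]
      exact ⟨h2.comp j, h3.comp j⟩)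
    have h5 : g.left (j.left y) = (Sp.map φ).left y := by
      rw [← hφ]
      rfl
    rw [h5]
    refine Set.singleton_subset_iff.mpr ?_
    have h6 : φ e = 0 := h4 (hIe ▸ Ideal.mem_span_singleton_self e)
    change φ e ∈ PrimeSpectrum.asIdeal (R := R') y
    rw [h6]
    exact zero_mem _
  · have h2 : ∀ y : T.left, ∃ (R' : Type u) (_ : CommRing R') (_ : Algebra k R') (j : Sp k R' ⟶ T),
        IsOpenImmersion j.left ∧ y ∈ Set.range j.left ∧ ConstAlong f (j ≫ g ≫ q) ∧
          ConstAlong f' (j ≫ g ≫ q) := by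
      intro y
      obtain ⟨R', _, _, j, hj, y, rfl⟩ := exists_affine_nhd T y
      obtain ⟨φ, hφ⟩ := Sp.exists_map_eq (j ≫ g)
      have hφe : φ e = 0 := by
        have hnil : IsNilpotent (φ e) := by
          rw [nilpotent_iff_mem_prime]
          intro p hp
          have h4 : (Sp.map φ).left (⟨p, hp⟩ : PrimeSpectrum R') ∈ PrimeSpectrum.zeroLocus {e} := by
            rw [← hφ]
            exact hD ⟨_, rfl⟩
          have h5 : ({φ e} : Set R') ⊆ p := by
            rintro _ rfl
            exact h4 rfl
          exact Set.singleton_subset_iff.mp h5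
        obtain ⟨m, hm⟩ := hnil
        have h5 : IsIdempotentElem (φ e) := he.map φ
        have h6 := h5.pow_succ_eq m
        rw [← h6, pow_succ, hm, zero_mul]
      refine ⟨R', inferInstance, inferInstance, j, hj, ⟨y, rfl⟩, ?_⟩
      rw [← Category.assoc, hφ, hc, hIe]
      exact (Ideal.span_singleton_le_iff_mem _).mpr hφe
    constructor
    · refine constAlong_of_etale_local hZ.isSheaf f _ fun y => ?_
      obtain ⟨R', _, _, j, hj, hy, h3, -⟩ := h2 y
      exact ⟨_, j, inferInstance, hy, h3⟩
    · refine constAlong_of_etale_local hZ.isSheaf f' _ fun y => ?_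
      obtain ⟨R', _, _, j, hj, hy, -, h3⟩ := h2 y
      exact ⟨_, j, inferInstance, hy, h3⟩

section ConstLocus

variable {Z : PreSpace k} {S : Sch k} {a : GmAction Z} {f f' : Z.obj (op (S ⊗ affineLine k))}

/-- The set of points of `S` over which both `f` and `f'` are constant, possibly after a base change
which hits the point. -/
def constLocus (f f' : Z.obj (op (S ⊗ affineLine k))) : Set S.left :=
  {s | ∃ (T : Sch k) (g : T ⟶ S), s ∈ Set.range g.left ∧ ConstAlong f g ∧ ConstAlong f' g}

/-- The locus of constancy may be computed étale locally. -/
theorem preimage_constLocus {S' : Sch k} (q : S' ⟶ S) [Etale q.left] {D : Set S'.left}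
    (hopen : IsOpen D) (hD : ∀ (T : Sch k) (g : T ⟶ S'),
      ConstAlong f (g ≫ q) ∧ ConstAlong f' (g ≫ q) ↔ Set.range g.left ⊆ D) :
    q.left ⁻¹' constLocus f f' = D := by
  apply Set.Subset.antisymm
  · rintro x ⟨T, g, ⟨t, ht⟩, h₁, h₂⟩
    obtain ⟨P, a, b, y, hab, -, hy, hy'⟩ := exists_etale_pullback g q t x ht
    have h := (hD P b).mp (by
      rw [← hab]
      exact ⟨h₁.comp a, h₂.comp a⟩)
    exact h ⟨y, hy'⟩
  · intro x hx
    let Ω : S'.left.Opens := ⟨D, hopen⟩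
    let i : Over.mk (Ω.ι ≫ S'.hom) ⟶ S' := Over.homMk Ω.ι
    have hi : Set.range i.left ⊆ D := by
      rintro _ ⟨y, rfl⟩
      exact y.2
    have h := (hD _ i).mpr hi
    exact ⟨_, i ≫ q, ⟨⟨x, hx⟩, rfl⟩, h.1, h.2⟩

theorem isClopen_constLocus (hZ : IsAlgebraicSpace Z) (hft : IsFiniteType Z)
    (hf : IsEquivariant (lineAction k 1) a f) (hf' : IsEquivariant (lineAction k (-1)) a f')
    (h1 : ∀ (T : Sch k) (s : T ⟶ S), evalAt f s 1 = evalAt f' s 1) :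
    IsClopen (constLocus f f') := by
  constructor
  · rw [← isOpen_compl_iff, isOpen_iff_forall_mem_open]
    intro s hs
    obtain ⟨S', q, D, hq, ⟨x, rfl⟩, hclopen, hD⟩ := exists_isClopen_constAlong_iff hZ hft hf hf' h1 s
    have hpre := preimage_constLocus q hclopen.isOpen hD
    refine ⟨q.left '' Dᶜ, ?_, q.left.isOpenMap _ hclopen.compl.isOpen, ⟨x, ?_, rfl⟩⟩
    · rintro _ ⟨y, hy, rfl⟩
      rwa [← hpre] at hy
    · rwa [← hpre]
  · rw [isOpen_iff_forall_mem_open]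
    intro s hs
    obtain ⟨S', q, D, hq, ⟨x, rfl⟩, hclopen, hD⟩ := exists_isClopen_constAlong_iff hZ hft hf hf' h1 s
    have hpre := preimage_constLocus q hclopen.isOpen hD
    refine ⟨q.left '' D, ?_, q.left.isOpenMap _ hclopen.isOpen, ⟨x, ?_, rfl⟩⟩
    · rintro _ ⟨y, hy, rfl⟩
      rwa [← hpre] at hy
    · rwa [← hpre]

/-- The families `f` and `f'` become constant after a base change if and only if it factors through
the locus of constancy. -/
theorem constAlong_iff_range_subset (hZ : IsAlgebraicSpace Z) (hft : IsFiniteType Z)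
    (hf : IsEquivariant (lineAction k 1) a f) (hf' : IsEquivariant (lineAction k (-1)) a f')
    (h1 : ∀ (T : Sch k) (s : T ⟶ S), evalAt f s 1 = evalAt f' s 1)
    {T : Sch k} (g : T ⟶ S) :
    ConstAlong f g ∧ ConstAlong f' g ↔ Set.range g.left ⊆ constLocus f f' := by
  refine ⟨?_, fun h => ?_⟩
  · rintro h _ ⟨t, rfl⟩
    exact ⟨T, g, ⟨t, rfl⟩, h⟩
  · have key : ∀ t : T.left, ∃ (P : Sch k) (p : P ⟶ T), Etale p.left ∧ t ∈ Set.range p.left ∧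
        ConstAlong f (p ≫ g) ∧ ConstAlong f' (p ≫ g) := by
      intro t
      obtain ⟨S', q, D, hq, ⟨x, hx⟩, hclopen, hD⟩ :=
        exists_isClopen_constAlong_iff hZ hft hf hf' h1 (g.left t)
      have hpre := preimage_constLocus q hclopen.isOpen hD
      obtain ⟨P, p, r, y, hpr, hp, hy, -⟩ := exists_etale_pullback g q t x hx.symm
      refine ⟨P, p, hp, ⟨y, hy⟩, ?_⟩
      rw [hpr, hD, ← hpre]
      rintro _ ⟨z, rfl⟩
      refine h ⟨p.left z, ?_⟩
      rw [← Scheme.Hom.comp_apply, ← Scheme.Hom.comp_apply, ← Over.comp_left, ← Over.comp_left, hpr]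
    constructor
    · refine constAlong_of_etale_local hZ.isSheaf f g fun t => ?_
      obtain ⟨P, p, hp, ht, h2, -⟩ := key t
      exact ⟨P, p, hp, ht, h2⟩
    · refine constAlong_of_etale_local hZ.isSheaf f' g fun t => ?_
      obtain ⟨P, p, hp, ht, -, h2⟩ := key t
      exact ⟨P, p, hp, ht, h2⟩

end ConstLocus

/-! ### Sections of `Z⁺ ×_Z Z⁻` -/

section

variable {Z : PreSpace k} {a : GmAction Z}

theorem eval_linePointOne {S : Sch k} {n : ℤ} (f : (GMaps (lineAction k n) a).obj (op S)) :
    (GMaps.eval (linePointOne k) a).app (op S) f = evalAt f.1 (𝟙 S) 1 := by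
  change Z.map (lift (𝟙 S) (toUnit S ≫ linePointOne k)).op f.1 = _
  rw [linePointOne, comp_pointOfCoordinate, map_one]
  rfl

/-- The family of maps `𝔸¹ → Z` given by a section of `Z⁺ ×_Z Z⁻`. -/
noncomputable def plusPart {S : Sch k} (y : (pullback (pPlus a) (pMinus a)).obj (op S)) :
    (attractor a).obj (op S) :=
  (pullback.fst (pPlus a) (pMinus a)).app (op S) y

/-- The family of maps `𝔸¹₋ → Z` given by a section of `Z⁺ ×_Z Z⁻`. -/
noncomputable def minusPart {S : Sch k} (y : (pullback (pPlus a) (pMinus a)).obj (op S)) :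
    (repeller a).obj (op S) :=
  (pullback.snd (pPlus a) (pMinus a)).app (op S) y

theorem plusPart_map {S T : Sch k} (g : T ⟶ S) (y : (pullback (pPlus a) (pMinus a)).obj (op S)) :
    (plusPart ((pullback (pPlus a) (pMinus a)).map g.op y)).1 =
      Z.map (g ▷ affineLine k).op (plusPart y).1 :=
  congrArg Subtype.val (NatTrans.naturality_apply (pullback.fst (pPlus a) (pMinus a)) g.op y)

theorem minusPart_map {S T : Sch k} (g : T ⟶ S) (y : (pullback (pPlus a) (pMinus a)).obj (op S)) :
    (minusPart ((pullback (pPlus a) (pMinus a)).map g.op y)).1 =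
      Z.map (g ▷ affineLine k).op (minusPart y).1 :=
  congrArg Subtype.val (NatTrans.naturality_apply (pullback.snd (pPlus a) (pMinus a)) g.op y)

theorem evalAt_one_eq {S : Sch k} (y : (pullback (pPlus a) (pMinus a)).obj (op S)) (T : Sch k)
    (s : T ⟶ S) : evalAt (plusPart y).1 s 1 = evalAt (minusPart y).1 s 1 := by
  have h := congrArg (fun φ => φ.app (op S) y) (pullback.condition (f := pPlus a) (g := pMinus a))
  have h' : evalAt (plusPart y).1 (𝟙 S) 1 = evalAt (minusPart y).1 (𝟙 S) 1 := by
    exact (eval_linePointOne (plusPart y)).symm.trans (h.trans (eval_linePointOne (minusPart y)))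
  have h'' := congrArg (Z.map s.op) h'
  rwa [map_evalAt, map_evalAt, map_one, Category.comp_id] at h''

theorem pullback_ext {S : Sch k} {y y' : (pullback (pPlus a) (pMinus a)).obj (op S)}
    (h₁ : plusPart y = plusPart y') (h₂ : minusPart y = minusPart y') : y = y' :=
  ((Types.isPullback_iff _ _ _ _).mp
    ((IsPullback.of_hasPullback (pPlus a) (pMinus a)).app (op S))).2.1 _ _ ⟨h₁, h₂⟩

theorem plusPart_jMap {S : Sch k} (x : (fixedPoints a).obj (op S)) :
    (plusPart ((jMap a).app (op S) x)) = (iPlus a).app (op S) x :=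
  congrArg (fun φ => φ.app (op S) x) (pullback.lift_fst (iPlus a) (iMinus a) _)

theorem minusPart_jMap {S : Sch k} (x : (fixedPoints a).obj (op S)) :
    (minusPart ((jMap a).app (op S) x)) = (iMinus a).app (op S) x :=
  congrArg (fun φ => φ.app (op S) x) (pullback.lift_snd (iPlus a) (iMinus a) _)

theorem evalAt_map_toUnit {S T : Sch k} (x : Z.obj (op (S ⊗ 𝟙_ (Sch k)))) (s : T ⟶ S)
    (v : Γ(T.left, ⊤)) :
    evalAt (Z.map (S ◁ toUnit (affineLine k)).op x) s v = Z.map (lift s (toUnit T)).op x := by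
  rw [evalAt, ← Functor.map_comp_apply, ← op_comp, lift_whiskerLeft, toUnit_unique (_ ≫ toUnit _)]

theorem jMap_injective (S : Sch k) : Function.Injective ((jMap a).app (op S)) := by
  intro x x' h
  have h1 := congrArg (fun y => evalAt (plusPart y).1 (fst S (𝟙_ (Sch k))) 0) h
  simp only [plusPart_jMap] at h1
  have h2 : ∀ x : (fixedPoints a).obj (op S),
      evalAt ((iPlus a).app (op S) x).1 (fst S (𝟙_ (Sch k))) 0 = x.1 := by
    intro x
    refine (evalAt_map_toUnit _ _ _).trans ?_
    have : lift (fst S (𝟙_ (Sch k))) (toUnit (S ⊗ 𝟙_ (Sch k))) = 𝟙 _ := by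
      ext1 <;> simp [toUnit_unique (snd S (𝟙_ (Sch k))) (toUnit _)]
    rw [this, op_id, Functor.map_id_apply]
  rw [h2, h2] at h1
  exact Subtype.ext h1

/-- The image of `j` consists of the pairs of constant families. -/
theorem exists_jMap_eq_iff {S : Sch k} (y : (pullback (pPlus a) (pMinus a)).obj (op S)) :
    (∃ x, (jMap a).app (op S) x = y) ↔
      ConstAlong (plusPart y).1 (𝟙 S) ∧ ConstAlong (minusPart y).1 (𝟙 S) := by
  constructor
  · rintro ⟨x, rfl⟩
    rw [plusPart_jMap, minusPart_jMap]
    exact ⟨fun T s v => (evalAt_map_toUnit _ _ _).trans (evalAt_map_toUnit _ _ _).symm,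
      fun T s v => (evalAt_map_toUnit _ _ _).trans (evalAt_map_toUnit _ _ _).symm⟩
  · rintro ⟨h₁, h₂⟩
    let z : Z.obj (op S) := evalAt (plusPart y).1 (𝟙 S) 0
    have hz : ∀ {T : Sch k} (s : T ⟶ S), Z.map s.op z = evalAt (plusPart y).1 s 0 := fun s => by
      rw [map_evalAt, map_zero, Category.comp_id]
    have hzx : ∀ {T : Sch k} (s : T ⟶ S) (t : T ⟶ 𝟙_ (Sch k)),
        Z.map (lift s t).op (Z.map (fst S (𝟙_ (Sch k))).op z) = Z.map s.op z := fun s t => by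
      rw [← Functor.map_comp_apply, ← op_comp, lift_fst]
    let x : (fixedPoints a).obj (op S) := ⟨Z.map (fst S (𝟙_ (Sch k))).op z, fun T s t c => by
      rw [hzx, hzx, hz, act_evalAt_zero (plusPart y).2]⟩
    refine ⟨x, pullback_ext ?_ ?_⟩
    · rw [plusPart_jMap]
      apply Subtype.ext
      rw [← evalAt_fst_coordinate_snd (plusPart y).1,
        ← evalAt_fst_coordinate_snd ((iPlus a).app (op S) x).1]
      refine (evalAt_map_toUnit _ _ _).trans ?_
      rw [hzx, hz]
      have := h₁.eq (fst S (affineLine k)) 0 (coordinate (snd S (affineLine k)))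
      rwa [Category.comp_id] at this
    · rw [minusPart_jMap]
      apply Subtype.ext
      rw [← evalAt_fst_coordinate_snd (minusPart y).1,
        ← evalAt_fst_coordinate_snd ((iMinus a).app (op S) x).1]
      refine (evalAt_map_toUnit _ _ _).trans ?_
      have e₁ := h₁.eq (fst S (affineLine k)) 0 1
      have e₂ := h₂.eq (fst S (affineLine k)) 1 (coordinate (snd S (affineLine k)))
      rw [Category.comp_id] at e₁ e₂
      rw [hzx, hz, e₁, evalAt_one_eq, e₂]

end

/-! ### The morphism `j` is an open and closed embedding -/

section

theorem map_yonedaEquiv_apply {F : PreSpace k} {S T : Sch k} (η : yoneda.obj S ⟶ F) (g : T ⟶ S) :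
    F.map g.op (yonedaEquiv η) = η.app (op T) g := by
  obtain ⟨y, rfl⟩ := yonedaEquiv.symm.surjective η
  rw [yonedaEquiv.apply_symm_apply]
  exact (yonedaEquiv_symm_app_apply y _ g).symm

variable {Z : PreSpace k} {a : GmAction Z}

/-- The locus of constancy of a section `y` of `Z⁺ ×_Z Z⁻`. -/
def sectionLocus {S : Sch k} (y : (pullback (pPlus a) (pMinus a)).obj (op S)) : Set S.left :=
  constLocus (plusPart y).1 (minusPart y).1

theorem isClopen_sectionLocus (hZ : IsAlgebraicSpace Z) (hft : IsFiniteType Z) {S : Sch k}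
    (y : (pullback (pPlus a) (pMinus a)).obj (op S)) : IsClopen (sectionLocus y) :=
  isClopen_constLocus hZ hft (plusPart y).2 (minusPart y).2 (evalAt_one_eq y)

theorem constAlong_map_id {S T : Sch k} (f : Z.obj (op (S ⊗ affineLine k))) (g : T ⟶ S) :
    ConstAlong (Z.map (g ▷ affineLine k).op f) (𝟙 T) ↔ ConstAlong f g := by
  refine forall_congr' fun T' => forall_congr' fun s => forall_congr' fun v => ?_
  rw [evalAt_whiskerRight, evalAt_whiskerRight, Category.comp_id]

/-- The restriction of a section of `Z⁺ ×_Z Z⁻` along `g` lies in the image of `j` if and only if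
`g` factors through the locus of constancy. -/
theorem exists_jMap_eq_map_iff (hZ : IsAlgebraicSpace Z) (hft : IsFiniteType Z) {S T : Sch k}
    (y : (pullback (pPlus a) (pMinus a)).obj (op S)) (g : T ⟶ S) :
    (∃ x, (jMap a).app (op T) x = (pullback (pPlus a) (pMinus a)).map g.op y) ↔
      Set.range g.left ⊆ sectionLocus y := by
  rw [exists_jMap_eq_iff, plusPart_map, minusPart_map, constAlong_map_id, constAlong_map_id]
  exact constAlong_iff_range_subset hZ hft (plusPart y).2 (minusPart y).2 (evalAt_one_eq y) g

/-- The pullback of `j` to a scheme `S` is the inclusion of an open and closed subscheme. -/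
theorem exists_isPullback_jMap (hZ : IsAlgebraicSpace Z) (hft : IsFiniteType Z) {S : Sch k}
    (η : yoneda.obj S ⟶ pullback (pPlus a) (pMinus a)) :
    ∃ (T : Sch k) (ξ : yoneda.obj T ⟶ fixedPoints a) (i : T ⟶ S),
      IsPullback ξ (yoneda.map i) (jMap a) η ∧ IsOpenImmersion i.left ∧ IsClosedImmersion i.left := by
  let y : (pullback (pPlus a) (pMinus a)).obj (op S) := yonedaEquiv η
  have hy : ∀ {T : Sch k} (g : T ⟶ S), η.app (op T) g = (pullback (pPlus a) (pMinus a)).map g.op y :=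
    fun g => (map_yonedaEquiv_apply η g).symm
  have hclopen := isClopen_sectionLocus hZ hft y
  let Ω : S.left.Opens := ⟨sectionLocus y, hclopen.isOpen⟩
  let T : Sch k := Over.mk (Ω.ι ≫ S.hom)
  let i : T ⟶ S := Over.homMk Ω.ι
  have hopen : IsOpenImmersion i.left := inferInstanceAs (IsOpenImmersion Ω.ι)
  have hrange : Set.range i.left = sectionLocus y := Ω.range_ι
  obtain ⟨x, hx⟩ := (exists_jMap_eq_map_iff hZ hft y i).mpr hrange.subset
  have hξ : ∀ {T' : Sch k} (g : T' ⟶ T),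
      (yonedaEquiv.symm x).app (op T') g = (fixedPoints a).map g.op x :=
    fun g => yonedaEquiv_symm_app_apply x _ g
  have hj : ∀ {T' : Sch k} (g : T' ⟶ T),
      (jMap a).app (op T') ((fixedPoints a).map g.op x) =
        (pullback (pPlus a) (pMinus a)).map (g ≫ i).op y := fun g => by
    rw [NatTrans.naturality_apply, hx, ← Functor.map_comp_apply, ← op_comp]
  refine ⟨T, yonedaEquiv.symm x, i, ?_, hopen, ?_⟩
  · refine IsPullback.of_forall_isPullback_app fun T' => (Types.isPullback_iff _ _ _ _).mpr ⟨?_, ?_, ?_⟩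
    · refine ConcreteCategory.hom_ext _ _ fun (g : T'.unop ⟶ T) => ?_
      change (jMap a).app T' ((yonedaEquiv.symm x).app T' g) = η.app T' (g ≫ i)
      rw [hξ (T' := T'.unop) g, hy (T := T'.unop) (g ≫ i)]
      exact hj (T' := T'.unop) g
    · rintro (g : T'.unop ⟶ T) (g' : T'.unop ⟶ T) ⟨-, hg⟩
      have hg' : g ≫ i = g' ≫ i := hg
      apply Over.OverMorphism.ext
      rw [← cancel_mono i.left, ← Over.comp_left, hg', Over.comp_left]
    · intro x' (g : T'.unop ⟶ S) hg
      have hg' : (jMap a).app (op T'.unop) x' = (pullback (pPlus a) (pMinus a)).map g.op y :=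
        hg.trans (hy g)
      have hr := (exists_jMap_eq_map_iff hZ hft y g).mp ⟨x', hg'⟩
      rw [← hrange] at hr
      let l : T'.unop ⟶ T := Over.homMk (IsOpenImmersion.lift i.left g.left hr) (by
        change _ ≫ i.left ≫ S.hom = _
        rw [IsOpenImmersion.lift_fac_assoc]
        exact Over.w g)
      have hl : l ≫ i = g := Over.OverMorphism.ext (IsOpenImmersion.lift_fac i.left g.left hr)
      refine ⟨l, jMap_injective T'.unop ?_, hl⟩
      rw [hg', ← hl]
      exact (congrArg _ (hξ l)).trans (hj l)
  · exact IsClosedImmersion.of_isPreimmersion _ (hrange ▸ hclopen.isClosed)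

theorem respectsIso_over (P : MorphismProperty Scheme.{u}) [P.IsStableUnderBaseChange]
    (X : Scheme.{u}) : (P.over (X := X)).RespectsIso :=
  have := isStableUnderBaseChange_over P X
  inferInstance

theorem isOpenEmbedding_jMap (hZ : IsAlgebraicSpace Z) (hft : IsFiniteType Z) :
    IsOpenEmbedding (jMap a) := by
  have := respectsIso_over @IsOpenImmersion (Spec (CommRingCat.of k))
  refine MorphismProperty.relative.of_exists fun S η => ?_
  obtain ⟨T, ξ, i, h, ho, -⟩ := exists_isPullback_jMap hZ hft η
  exact ⟨T, ξ, i, h, ho⟩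

theorem isClosedEmbedding_jMap (hZ : IsAlgebraicSpace Z) (hft : IsFiniteType Z) :
    IsClosedEmbedding (jMap a) := by
  have := respectsIso_over @IsClosedImmersion (Spec (CommRingCat.of k))
  refine MorphismProperty.relative.of_exists fun S η => ?_
  obtain ⟨T, ξ, i, h, -, hc⟩ := exists_isPullback_jMap hZ hft η
  exact ⟨T, ξ, i, h, hc⟩

end

/-! ### The image of `j` on points -/

section

theorem subsingleton_spec_of_isField {K : CommRingCat.{u}} (hK : IsField K) :
    Subsingleton (Spec K) := by
  have h : ∀ (p : PrimeSpectrum K) (x : K), x ∈ p.asIdeal ↔ x = 0 := by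
    refine fun p x => ⟨fun hx => ?_, fun hx => hx ▸ zero_mem _⟩
    by_contra hne
    obtain ⟨y, hy⟩ := hK.mul_inv_cancel hne
    exact p.isPrime.ne_top ((Ideal.eq_top_iff_one _).mpr (hy ▸ Ideal.mul_mem_right y _ hx))
  exact ⟨fun (p p' : PrimeSpectrum K) => PrimeSpectrum.ext (Ideal.ext fun x => by rw [h, h])⟩

theorem nonempty_spec_of_isField {K : CommRingCat.{u}} (hK : IsField K) : Nonempty (Spec K) := by
  have := hK.nontrivial
  exact inferInstanceAs (Nonempty (PrimeSpectrum K))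

variable {Z : PreSpace k} {a : GmAction Z}

/-- A point of `Z⁺ ×_Z Z⁻` at which both maps to `Z` are constant. -/
def IsConstPoint (y : FieldPoint (pullback (pPlus a) (pMinus a))) : Prop :=
  ∃ x, (jMap a).app _ x = y.pt

/-- Whether a field-valued point lies in the image of `j` does not change under field extension,
as the locus of constancy is a subset of the underlying space of the spectrum of the field. -/
theorem isConstPoint_map_iff (hZ : IsAlgebraicSpace Z) (hft : IsFiniteType Z)
    (y : FieldPoint (pullback (pPlus a) (pMinus a))) {L : CommRingCat.{u}} (hL : IsField L)
    {str : Spec L ⟶ Spec (CommRingCat.of k)} (g : Over.mk str ⟶ Over.mk y.str) :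
    IsConstPoint y ↔ ∃ x, (jMap a).app _ x = (pullback (pPlus a) (pMinus a)).map g.op y.pt := by
  have h := exists_jMap_eq_map_iff hZ hft y.pt (𝟙 _)
  rw [op_id, Functor.map_id_apply] at h
  rw [IsConstPoint, h, exists_jMap_eq_map_iff hZ hft]
  have := subsingleton_spec_of_isField y.isField
  obtain ⟨t⟩ := nonempty_spec_of_isField hL
  have hsurj : Set.range g.left = Set.univ := Set.eq_univ_of_forall fun z =>
    ⟨t, Subsingleton.elim (α := Spec y.K) _ _⟩
  rw [hsurj, Over.id_left]
  have : Set.range (𝟙 (Over.mk y.str).left : (Over.mk y.str).left ⟶ _) = Set.univ :=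
    Set.eq_univ_of_forall fun z => ⟨z, rfl⟩
  rw [this]

theorem isConstPoint_iff_of_rel (hZ : IsAlgebraicSpace Z) (hft : IsFiniteType Z)
    {y y' : FieldPoint (pullback (pPlus a) (pMinus a))} (h : y.Rel y') :
    IsConstPoint y ↔ IsConstPoint y' := by
  obtain ⟨L, hL, str, g, g', h⟩ := h
  rw [isConstPoint_map_iff hZ hft y hL g, isConstPoint_map_iff hZ hft y' hL g', h]

theorem mem_range_map_jMap_iff (hZ : IsAlgebraicSpace Z) (hft : IsFiniteType Z)
    (y : FieldPoint (pullback (pPlus a) (pMinus a))) :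
    (Quot.mk _ y : Points (pullback (pPlus a) (pMinus a))) ∈ Set.range (Points.map (jMap a)) ↔
      IsConstPoint y := by
  constructor
  · rintro ⟨⟨x⟩, hx⟩
    have h := congrArg (Quot.lift (IsConstPoint (a := a))
      fun _ _ h => propext (isConstPoint_iff_of_rel hZ hft h)) hx
    exact (iff_of_eq h).mp ⟨x.pt, rfl⟩
  · rintro ⟨x, hx⟩
    refine ⟨Quot.mk _ ⟨y.K, y.isField, y.str, x⟩, ?_⟩
    change Quot.mk _ (FieldPoint.mk y.K y.isField y.str ((jMap a).app _ x)) = _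
    rw [hx]

theorem preimage_range_map_jMap (hZ : IsAlgebraicSpace Z) (hft : IsFiniteType Z) {S : Sch k}
    (y : (pullback (pPlus a) (pMinus a)).obj (op S)) :
    Points.ofSection y ⁻¹' Set.range (Points.map (jMap a)) = sectionLocus y := by
  ext s
  refine (mem_range_map_jMap_iff hZ hft _).trans ((exists_jMap_eq_map_iff hZ hft y _).trans ?_)
  change Set.range (S.left.fromSpecResidueField s) ⊆ _ ↔ _
  rw [Scheme.range_fromSpecResidueField, Set.singleton_subset_iff]

theorem isClopen_range_map_jMap (hZ : IsAlgebraicSpace Z) (hft : IsFiniteType Z) :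
    IsClopen (Set.range (Points.map (jMap a))) := by
  constructor
  · rw [isClosed_iSup_iff]
    intro S
    rw [isClosed_iSup_iff]
    intro y
    rw [isClosed_coinduced, preimage_range_map_jMap hZ hft]
    exact (isClopen_sectionLocus hZ hft y).isClosed
  · rw [isOpen_iSup_iff]
    intro S
    rw [isOpen_iSup_iff]
    intro y
    rw [isOpen_coinduced, preimage_range_map_jMap hZ hft]
    exact (isClopen_sectionLocus hZ hft y).isOpen

theorem exists_eq_preimage_connectedComponents {X : Type*} [TopologicalSpace X] {s : Set X}
    (hs : IsClopen s) : ∃ C : Set (ConnectedComponents X), s = ConnectedComponents.mk ⁻¹' C := by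
  refine ⟨ConnectedComponents.mk '' s, Set.Subset.antisymm (Set.subset_preimage_image _ _) ?_⟩
  rintro x ⟨y, hy, hyx⟩
  exact hs.connectedComponent_subset hy
    ((ConnectedComponents.coe_eq_coe.mp hyx) ▸ mem_connectedComponent)

end

/-! ### Affine schemes -/

section

open Polynomial LaurentPolynomial

variable {Z : PreSpace k} {a : GmAction Z}

/-- An affine scheme has a universal section over a spectrum. -/
theorem IsAffineScheme.exists_universal (hZ : IsAffineScheme Z) :
    ∃ (A : Type u) (_ : CommRing A) (_ : Algebra k A) (u₀ : Z.obj (op (Sp k A))),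
      ∀ (T : Sch k) (z : Z.obj (op T)), ∃! g : T ⟶ Sp k A, Z.map g.op u₀ = z := by
  obtain ⟨X, hX, ⟨e⟩⟩ := hZ
  obtain ⟨φ, hφ⟩ := Spec.map_surjective (X.left.isoSpec.inv ≫ X.hom)
  let _ : Algebra k Γ(X.left, ⊤) := φ.hom.toAlgebra
  let c : Sp k Γ(X.left, ⊤) ≅ X := Over.isoMk X.left.isoSpec.symm hφ.symm
  let e' : yoneda.obj (Sp k Γ(X.left, ⊤)) ≅ Z := yoneda.mapIso c ≪≫ e
  refine ⟨Γ(X.left, ⊤), inferInstance, inferInstance, yonedaEquiv e'.hom, fun T z => ?_⟩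
  have h : ∀ g : T ⟶ Sp k Γ(X.left, ⊤), Z.map g.op (yonedaEquiv e'.hom) = e'.hom.app (op T) g :=
    fun g => map_yonedaEquiv_apply e'.hom g
  refine ⟨e'.inv.app (op T) z, ?_, fun g hg => ?_⟩
  · refine (h _).trans ?_
    exact congrArg (fun ψ => ψ.app (op T) z) e'.inv_hom_id
  · rw [← hg]
    dsimp only
    rw [h]
    exact (congrArg (fun ψ => ψ.app (op T) g) e'.hom_inv_id).symm

theorem isIso_jMap_of_isAffineScheme (hZ : IsAlgebraicSpace Z) (haff : IsAffineScheme Z) :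
    IsIso (jMap a) := by
  obtain ⟨A, _, _, u₀, hu₀⟩ := haff.exists_universal
  rw [NatTrans.isIso_iff_isIso_app]
  intro S
  rw [isIso_iff_bijective]
  refine ⟨jMap_injective S.unop, fun y => (exists_jMap_eq_iff (S := S.unop) y).mpr ?_⟩
  have key : ∀ t : S.unop.left, ∃ (R : Type u) (_ : CommRing R) (_ : Algebra k R)
      (q : Sp k R ⟶ S.unop), IsOpenImmersion q.left ∧ t ∈ Set.range q.left ∧
        ConstAlong (plusPart y).1 q ∧ ConstAlong (minusPart y).1 q := by
    intro t
    obtain ⟨R, _, _, q, hq, ht⟩ := exists_affine_nhd S.unop t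
    obtain ⟨g, hg, -⟩ := hu₀ _ (evalAt (plusPart y).1 (Sp.map CAlgHom ≫ q) (gl (X : R[X])))
    obtain ⟨g', hg', -⟩ := hu₀ _ (evalAt (minusPart y).1 (Sp.map CAlgHom ≫ q) (gl (X : R[X])))
    obtain ⟨g, rfl⟩ := Sp.exists_map_eq g
    obtain ⟨g', rfl⟩ := Sp.exists_map_eq g'
    exact ⟨R, inferInstance, inferInstance, q, hq, ht,
      constAlong_of_lifts (plusPart y).2 (minusPart y).2 (evalAt_one_eq y) hg hg' fun h x =>
        congrArg (· x) (Sp.map_injective ((hu₀ _ _).unique h rfl))⟩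
  constructor
  · refine constAlong_of_etale_local hZ.isSheaf _ _ fun t => ?_
    obtain ⟨R, _, _, q, hq, ht, h, -⟩ := key t
    exact ⟨_, q, inferInstance, ht, by rwa [Category.comp_id]⟩
  · refine constAlong_of_etale_local hZ.isSheaf _ _ fun t => ?_
    obtain ⟨R, _, _, q, hq, ht, -, h⟩ := key t
    exact ⟨_, q, inferInstance, ht, by rwa [Category.comp_id]⟩

end

end GmSpace


theorem proposition1p8p2 {k : Type u} [Field k] (Z : GmSpace.PreSpace k)
    (hZ : GmSpace.IsAlgebraicSpace Z) (hft : GmSpace.IsFiniteType Z) (a : GmSpace.GmAction Z) :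
    GmSpace.IsOpenEmbedding (GmSpace.jMap a) ∧
    GmSpace.IsClosedEmbedding (GmSpace.jMap a) ∧
    (∃ C : Set (ConnectedComponents
        (GmSpace.Points (Limits.pullback (GmSpace.pPlus a) (GmSpace.pMinus a)))),
      Set.range (GmSpace.Points.map (GmSpace.jMap a)) = ConnectedComponents.mk ⁻¹' C) ∧
    (GmSpace.IsAffineScheme Z → IsIso (GmSpace.jMap a)) :=
  ⟨GmSpace.isOpenEmbedding_jMap hZ hft, GmSpace.isClosedEmbedding_jMap hZ hft,
    GmSpace.exists_eq_preimage_connectedComponents (GmSpace.isClopen_range_map_jMap hZ hft),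
    GmSpace.isIso_jMap_of_isAffineScheme hZ⟩
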